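/- Let $V$ be an oriented Euclidean vector space of dimension $d$ with oriented orthonormal basis $(e_1,\dots,e_d)$ and coordinates $x_k=\langle e_k,x\rangle$; orient $V$ by $dx_1\wedge\cdots\wedge dx_d$. Let $\mathfrak{so}(V)$ be the antisymmetric endomorphisms of $V$. For an $SO(V)$-invariant open set $U\subseteq V$, let $\mathcal A(U)$ be the smooth differential forms on $U$, and let $\mathcal A^{\mathrm{pol}}(\mathfrak{so}(V),U)=(\mathcal C^{\mathrm{pol}}(\mathfrak{so}(V))\otimes\mathcal A(U))^{SO(V)}$ be the space of $SO(V)$-equivariant polynomial maps $\alpha:\mathfrak{so}(V)\to\mathcal A(U)$, with the differential $(D\alpha)(X)=d(\alpha(X))-\iota(VX)\,\alpha(X)$, where $VX$ is the vector field $x\mapsto\frac{d}{d\epsilon}e^{-\epsilon X}x|_{\epsilon=0}=-Xx$. Let $\mathcal A_c^{\mathrm{pol}}(\mathfrak{so}(V),V)=(\mathcal C^{\mathrm{pol}}(\mathfrak{so}(V))\otimes\mathcal A_c(V))^{SO(V)}$, where $\mathcal A_c(V)$ is the space of compactly supported forms, and let $\mathcal A_{\mathrm{dec\text{-}rap}}^{\mathrm{pol}}(\mathfrak{so}(V),V)$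 be the subspace of those $\alpha\in\mathcal A^{\mathrm{pol}}(\mathfrak{so}(V),V)$ such that all partial derivatives of $\alpha(X)$ are rapidly decreasing for every $X$. Let $\mathcal A^{\mathrm{pol}}(\mathfrak{so}(V),V,V\setminus\{0\})=\mathcal A^{\mathrm{pol}}(\mathfrak{so}(V),V)\oplus\mathcal A^{\mathrm{pol}}(\mathfrak{so}(V),V\setminus\{0\})$ with the differential $D_{\mathrm{rel}}(\alpha,\beta)=(D\alpha,\ \alpha|_{V\setminus\{0\}}-D\beta)$. The corresponding cohomology spaces (kernel of the differential modulo its image) are denoted $\mathcal H_c^{\mathrm{pol}}$, $\mathcal H_{\mathrm{dec\text{-}rap}}^{\mathrm{pol}}$ and $\mathcal H^{\mathrm{pol}}(\mathfrak{so}(V),V,V\setminus\{0\})$. A *cut-off function* is an $SO(V)$-invariant function $\chi\in C^\infty(V)$ with compact support that is equal to $1$ in a neighbourhood of $0$. A *Thom form* is a closed element of one of the three complexes above whose integral over $V$ is $1$ for every $X\in\mathfrak{so}(V)$; the integral of a closed pair $(\alpha,\beta)$ is $\int_V(\chi\alpha+d\chi\wedge\beta)$, and $(\alpha,\beta)$ is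 a Thom form if this is $1$ for every cut-off function $\chi$. A *Thom class* is the cohomology class of a Thom form. Let $T:\wedge V\to\mathbb R$ be the Berezin integral, which vanishes in degrees $<d$ and satisfies $T(e_1\wedge\cdots\wedge e_d)=1$, extended to the graded tensor product $\mathcal A(V)\otimes\wedge V$ by $T(\alpha\otimes\xi)=\alpha\,T(\xi)$. For $X\in\mathfrak{so}(V)$ and $t\in\mathbb R$ put $$\mathrm{Pf}(X)=T\Big(e^{\sum_{k<l}\langle Xe_k,e_l\rangle e_k\wedge e_l}\Big),\qquad f_t(X)=-t^2\|x\|^2+t\sum_k dx_k\,e_k+\tfrac12\sum_{k<l}\langle Xe_k,e_l\rangle\, e_k\wedge e_l ,$$ $$\eta_\wedge^t(X)=-T\Big(\big(\textstyle\sum_k x_ke_k\big)e^{f_t(X)}\Big),\qquad \beta_\wedge(X)=\int_0^\infty\eta_\wedge^t(X)\,dt\quad\text{on }V\setminus\{0\},$$ the exponentials being taken in $\wedge V$ and in the super-algebra $\mathcal A(V)\otimes\wedge V$ respectively. Let $\epsilon_d=(-1)^{d(d-1)/2}\pi^{d/2}$. Then for all $X$ and all $x\ne0$ the integral defining $\beta_\wedge(X)$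 at $x$ converges absolutely, and: 1. $\mathrm{Th}_{\mathrm{rel}}(V)=\frac1{\epsilon_d}\big(\mathrm{Pf}(\tfrac X2),\beta_\wedge(X)\big)$ belongs to $\mathcal A^{\mathrm{pol}}(\mathfrak{so}(V),V,V\setminus\{0\})$ and is a Thom form; it defines a Thom class in $\mathcal H^{\mathrm{pol}}(\mathfrak{so}(V),V,V\setminus\{0\})$. 2. For every cut-off function $\chi$, $\mathrm{Th}_c(V)=\frac1{\epsilon_d}\big(\chi\,\mathrm{Pf}(\tfrac X2)+d\chi\wedge\beta_\wedge(X)\big)$ belongs to $\mathcal A_c^{\mathrm{pol}}(\mathfrak{so}(V),V)$ and is a Thom form; it defines a Thom class in $\mathcal H_c^{\mathrm{pol}}(\mathfrak{so}(V),V)$. 3. $\mathrm{Th}_{\mathrm{MQ}}(V)=\frac1{\epsilon_d}T\big(e^{f_1(X)}\big)$ belongs to $\mathcal A_{\mathrm{dec\text{-}rap}}^{\mathrm{pol}}(\mathfrak{so}(V),V)$ and is a Thom form; it defines a Thom class in $\mathcal H_{\mathrm{dec\text{-}rap}}^{\mathrm{pol}}(\mathfrak{so}(V),V)$. -/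

import Mathlib

open MeasureTheory Set Filter Topology
open scoped ContDiff TensorProduct InnerProductSpace

noncomputable section

namespace EquivariantThom

variable (V : Type*) [NormedAddCommGroup V] [InnerProductSpace ℝ V]

/-! ### The group `SO(V)`, its Lie algebra and its polynomial functions -/

/-- `SO(V)`: the linear isometries of `V` of determinant `1`. -/
def SO : Subgroup (V ≃ₗᵢ[ℝ] V) where
  carrier := {g | LinearMap.det (g.toLinearEquiv : V →ₗ[ℝ] V) = 1}
  one_mem' := by
    have h : (((1 : V ≃ₗᵢ[ℝ] V).toLinearEquiv : V ≃ₗ[ℝ] V) : V →ₗ[ℝ] V) = LinearMap.id := rfl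
    simp only [mem_ofPred_eq, h, LinearMap.det_id]
  mul_mem' := by
    intro g h hg hh
    have e : (((g * h : V ≃ₗᵢ[ℝ] V).toLinearEquiv : V ≃ₗ[ℝ] V) : V →ₗ[ℝ] V)
      = (g.toLinearEquiv : V →ₗ[ℝ] V) ∘ₗ (h.toLinearEquiv : V →ₗ[ℝ] V) := rfl
    simp only [mem_ofPred_eq] at hg hh ⊢
    rw [e, LinearMap.det_comp, hg, hh, one_mul]
  inv_mem' := by
    intro g hg
    simp only [mem_ofPred_eq] at hg ⊢
    have e : ((g.toLinearEquiv : V →ₗ[ℝ] V)) ∘ₗ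
      (((g⁻¹ : V ≃ₗᵢ[ℝ] V).toLinearEquiv : V ≃ₗ[ℝ] V) : V →ₗ[ℝ] V) = LinearMap.id := by
      ext x
      exact g.apply_symm_apply x
    have e' := congrArg LinearMap.det e
    rwa [LinearMap.det_comp, hg, one_mul, LinearMap.det_id] at e'

/-- `𝔰𝔬(V)`: the antisymmetric endomorphisms of `V`. -/
abbrev so : Submodule ℝ (Module.End ℝ V) := (innerₗ V).skewAdjointSubmodule

variable {V}

/-- The adjoint action `X ↦ g X g⁻¹`. -/
def Ad (g : V ≃ₗᵢ[ℝ] V) (X : so V) : so V :=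
  ⟨(g.toLinearEquiv : V →ₗ[ℝ] V) ∘ₗ (X : Module.End ℝ V) ∘ₗ (g.symm.toLinearEquiv : V →ₗ[ℝ] V), by
    have hX : (innerₗ V).IsSkewAdjoint (X : Module.End ℝ V) :=
      (LinearMap.mem_skewAdjointSubmodule _).1 X.2
    refine (LinearMap.mem_skewAdjointSubmodule _).2 fun u v => ?_
    have h := hX (g.symm u) (g.symm v)
    simp only [innerₗ_apply_apply, Pi.neg_apply, inner_neg_right] at h ⊢
    have h1 : ⟪g ((X : Module.End ℝ V) (g.symm u)), v⟫_ℝ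
        = ⟪(X : Module.End ℝ V) (g.symm u), g.symm v⟫_ℝ := by
      rw [← g.inner_map_map _ (g.symm v), g.apply_symm_apply]
    have h2 : ⟪u, g ((X : Module.End ℝ V) (g.symm v))⟫_ℝ
        = ⟪g.symm u, (X : Module.End ℝ V) (g.symm v)⟫_ℝ := by
      rw [← g.inner_map_map (g.symm u) _, g.apply_symm_apply]
    exact h1.trans (h.trans (congrArg Neg.neg h2.symm))⟩

variable (V) in
/-- The algebra of polynomial functions on `𝔰𝔬(V)`: generated by the linear forms. -/
def polyFun : Subalgebra ℝ (so V → ℝ) :=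
  Algebra.adjoin ℝ {p | ∃ l : Module.Dual ℝ (so V), p = fun X => l X}

/-- The vector field on `V` generated by `X`, i.e. `x ↦ d/dε exp(-εX) x` at `ε = 0`. -/
def vectorField (X : so V) (x : V) : V := -((X : Module.End ℝ V) x)

theorem hasDerivAt_exp_vectorField [FiniteDimensional ℝ V] (X : so V) (x : V) :
    HasDerivAt (fun ε : ℝ => NormedSpace.exp
      (-ε • LinearMap.toContinuousLinearMap (X : Module.End ℝ V)) x) (vectorField X x) 0 := by
  have : CompleteSpace V := FiniteDimensional.complete ℝ V
  have h := hasDerivAt_exp_smul_const (𝕂 := ℝ)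
    (-LinearMap.toContinuousLinearMap (X : Module.End ℝ V)) (0 : ℝ)
  have h' := (ContinuousLinearMap.apply ℝ V x).hasFDerivAt.comp_hasDerivAt (0 : ℝ) h
  simpa [vectorField, Function.comp_def] using h'

/-! ### Differential forms -/

variable (V) in
/-- Fields of differential forms of mixed degree on `V`: the component of index `k` has degree `k`
(it vanishes automatically for `k > dim V`). -/
abbrev MForm := ∀ k : ℕ, V → V [⋀^Fin k]→L[ℝ] ℝ

variable (V) in
/-- Maps from `𝔰𝔬(V)` to forms of mixed degree. -/
abbrev EForm := so V → MForm V

variable (V) in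
/-- The space `𝒜(U)` of smooth forms on an open set `U`; a form on `U` is recorded by its
extension by zero to `V`. -/
def smoothForms (U : Set V) : Submodule ℝ (MForm V) where
  carrier := {θ | ∀ k, ContDiffOn ℝ ∞ (θ k) U ∧ ∀ x ∉ U, θ k x = 0}
  zero_mem' := fun k => ⟨contDiffOn_const, fun _ _ => rfl⟩
  add_mem' := fun {a c} ha hc k => ⟨(ha k).1.add (hc k).1, fun x hx => by
    simp [(ha k).2 x hx, (hc k).2 x hx]⟩
  smul_mem' := fun r a ha k => ⟨(ha k).1.const_smul r, fun x hx => by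
    simp [(ha k).2 x hx]⟩

variable (V) in
/-- The space `𝒜_c(V)` of compactly supported smooth forms on `V`. -/
def compactForms : Submodule ℝ (MForm V) where
  carrier := {θ | ∀ k, ContDiff ℝ ∞ (θ k) ∧ HasCompactSupport (θ k)}
  zero_mem' := fun _ => ⟨contDiff_const, HasCompactSupport.zero⟩
  add_mem' := fun {_ _} ha hc k => ⟨(ha k).1.add (hc k).1, (ha k).2.add (hc k).2⟩
  smul_mem' := fun r _ ha k => ⟨(ha k).1.const_smul r, (ha k).2.smul_left (f := fun _ => r)⟩

/-- A smooth form all of whose partial derivatives are rapidly decreasing. -/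
def IsRapidlyDecreasing (θ : MForm V) : Prop :=
  ∀ k, ContDiff ℝ ∞ (θ k) ∧
    ∀ m n : ℕ, ∃ C : ℝ, ∀ x : V, ‖x‖ ^ m * ‖iteratedFDeriv ℝ n (θ k) x‖ ≤ C

/-- Restriction of a form to `U` (recorded by its extension by zero). -/
def res (U : Set V) (θ : MForm V) : MForm V := fun k => U.indicator (θ k)

/-- Restriction to `U` of `𝔰𝔬(V)`-dependent forms, as a linear map. -/
def resMap (U : Set V) : EForm V →ₗ[ℝ] EForm V where
  toFun α := fun X => res U (α X)
  map_add' α β := by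
    funext X k
    exact indicator_add U (α X k) (β X k)
  map_smul' r α := by
    funext X k
    exact indicator_const_smul U r (α X k)

/-- The de Rham differential. -/
def deRham (θ : MForm V) : MForm V
  | 0 => 0
  | k + 1 => extDeriv (θ k)

/-- Contraction with the vector field `S`: `(ι(S) θ)(v₁, …, v_k) = θ(S, v₁, …, v_k)`. -/
def contract (S : V → V) (θ : MForm V) : MForm V := fun k x => (θ (k + 1) x).curryLeft (S x)

/-- The product `φ ∧ θ` of a `1`-form with a `k`-form at a point:
`(φ ∧ θ)(v₀, …, v_k) = ∑ᵢ (-1)ⁱ φ(vᵢ) θ(v₀, …, v̂ᵢ, …, v_k)`. -/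
def wedgeOne {k : ℕ} (φ : V →L[ℝ] ℝ) (θ : V [⋀^Fin k]→L[ℝ] ℝ) : V [⋀^Fin (k + 1)]→L[ℝ] ℝ :=
  ContinuousAlternatingMap.alternatizeUncurryFin (φ.smulRight θ)

/-! ### Equivariant forms -/

/-- The tensor product of the polynomial functions on `𝔰𝔬(V)` with a space `S` of forms, seen as
a space of maps `𝔰𝔬(V) → S`. -/
def polyForms (S : Submodule ℝ (MForm V)) : Submodule ℝ (EForm V) :=
  Submodule.span ℝ {α | ∃ P ∈ polyFun V, ∃ θ ∈ S, α = fun X => P X • θ}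

variable (V) in
/-- The `SO(V)`-equivariant maps: `g^*(α(g X g⁻¹)) = α(X)` for all `g` in `SO(V)`. -/
def equivariantMaps : Submodule ℝ (EForm V) where
  carrier := {α | ∀ g ∈ SO V, ∀ (X : so V) (k : ℕ) (x : V),
    (α (Ad g X) k (g x)).compContinuousLinearMap
      (g.toContinuousLinearEquiv : V →L[ℝ] V) = α X k x}
  zero_mem' := fun g _ X k x => by ext v; simp
  add_mem' := fun {a c} ha hc g hg X k x => by
    simp only [Pi.add_apply]
    rw [← ha g hg X k x, ← hc g hg X k x]
    ext v; simp
  smul_mem' := fun r a ha g hg X k x => by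
    simp only [Pi.smul_apply]
    rw [← ha g hg X k x]
    ext v; simp

variable (V) in
/-- `𝒜^pol(𝔰𝔬(V), U)`, for `U` open and `SO(V)`-invariant. -/
def Apol (U : Set V) : Submodule ℝ (EForm V) := polyForms (smoothForms V U) ⊓ equivariantMaps V

variable (V) in
/-- `𝒜_c^pol(𝔰𝔬(V), V)`. -/
def ApolC : Submodule ℝ (EForm V) := polyForms (compactForms V) ⊓ equivariantMaps V

variable (V) in
/-- `𝒜_dec-rap^pol(𝔰𝔬(V), V)`: the elements of `𝒜^pol(𝔰𝔬(V), V)` with rapidly decreasing values. -/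
def ApolDR : Submodule ℝ (EForm V) where
  carrier := {α | α ∈ Apol V univ ∧ ∀ X, IsRapidlyDecreasing (α X)}
  zero_mem' := ⟨Submodule.zero_mem _, fun X k => ⟨contDiff_const, fun m n => ⟨0, fun x => by
    have h : ((0 : EForm V) X k) = fun _ : V => 0 := rfl
    rw [h]
    simp⟩⟩⟩
  add_mem' := fun {a c} ha hc => ⟨Submodule.add_mem _ ha.1 hc.1, fun X k =>
    ⟨(ha.2 X k).1.add (hc.2 X k).1, fun m n => by
      obtain ⟨C₁, h₁⟩ := (ha.2 X k).2 m n
      obtain ⟨C₂, h₂⟩ := (hc.2 X k).2 m n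
      refine ⟨C₁ + C₂, fun x => ?_⟩
      have e : iteratedFDeriv ℝ n ((a + c) X k) x
          = iteratedFDeriv ℝ n (a X k) x + iteratedFDeriv ℝ n (c X k) x :=
        iteratedFDeriv_add_apply
          (((ha.2 X k).1.of_le (by exact_mod_cast le_top)).contDiffAt)
          (((hc.2 X k).1.of_le (by exact_mod_cast le_top)).contDiffAt)
      rw [e]
      calc ‖x‖ ^ m * ‖iteratedFDeriv ℝ n (a X k) x + iteratedFDeriv ℝ n (c X k) x‖
          ≤ ‖x‖ ^ m * (‖iteratedFDeriv ℝ n (a X k) x‖ + ‖iteratedFDeriv ℝ n (c X k) x‖) := by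
            gcongr
            exact norm_add_le _ _
        _ ≤ C₁ + C₂ := by
            rw [mul_add]
            exact add_le_add (h₁ x) (h₂ x)⟩⟩
  smul_mem' := fun r a ha => ⟨Submodule.smul_mem _ r ha.1, fun X k =>
    ⟨(ha.2 X k).1.const_smul r, fun m n => by
      obtain ⟨C₁, h₁⟩ := (ha.2 X k).2 m n
      refine ⟨|r| * C₁, fun x => ?_⟩
      have e : iteratedFDeriv ℝ n ((r • a) X k) x = r • iteratedFDeriv ℝ n (a X k) x :=
        iteratedFDeriv_const_smul_apply (a := r) (f := a X k)
          (((ha.2 X k).1.of_le (by exact_mod_cast le_top)).contDiffAt)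
      rw [e, norm_smul, Real.norm_eq_abs]
      calc ‖x‖ ^ m * (|r| * ‖iteratedFDeriv ℝ n (a X k) x‖)
          = |r| * (‖x‖ ^ m * ‖iteratedFDeriv ℝ n (a X k) x‖) := by ring
        _ ≤ |r| * C₁ := by
            gcongr
            exact h₁ x⟩⟩

variable (V) in
/-- `𝒜^pol(𝔰𝔬(V), V, V ∖ {0}) = 𝒜^pol(𝔰𝔬(V), V) ⊕ 𝒜^pol(𝔰𝔬(V), V ∖ {0})`. -/
def ApolRel : Submodule ℝ (EForm V × EForm V) := (Apol V univ).prod (Apol V {0}ᶜ)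

variable (V) in
/-- `(α, β) ↦ α`. -/
def relFst : ApolRel V →ₗ[ℝ] Apol V univ :=
  LinearMap.codRestrict _ (LinearMap.fst ℝ _ _ ∘ₗ (ApolRel V).subtype) fun p => p.2.1

variable (V) in
/-- `(α, β) ↦ β`. -/
def relSnd : ApolRel V →ₗ[ℝ] Apol V {0}ᶜ :=
  LinearMap.codRestrict _ (LinearMap.snd ℝ _ _ ∘ₗ (ApolRel V).subtype) fun p => p.2.2

/-- The formula `(Dα)(X) = d(α(X)) - ι(VX) α(X)` for the equivariant differential. -/
def equivD (α : EForm V) : EForm V := fun X => deRham (α X) - contract (vectorField X) (α X)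

theorem contDiffOn_of_mem_polyForms {S : Submodule ℝ (MForm V)} {U : Set V}
    (hS : ∀ θ ∈ S, ∀ k, ContDiffOn ℝ ∞ (θ k) U) {α : EForm V} (hα : α ∈ polyForms S)
    (X : so V) (k : ℕ) : ContDiffOn ℝ ∞ (α X k) U := by
  induction hα using Submodule.span_induction with
  | mem a ha =>
    obtain ⟨P, -, θ, hθ, rfl⟩ := ha
    exact (hS θ hθ k).const_smul (P X)
  | zero => exact contDiffOn_const
  | add a c _ _ ha hc => exact ha.add hc
  | smul r a _ ha => exact ha.const_smul r

theorem differentiableAt_of_mem_polyForms {S : Submodule ℝ (MForm V)} {U : Set V} (hU : IsOpen U)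
    (hS : ∀ θ ∈ S, ∀ k, ContDiffOn ℝ ∞ (θ k) U) {α : EForm V} (hα : α ∈ polyForms S)
    (X : so V) (k : ℕ) {x : V} (hx : x ∈ U) : DifferentiableAt ℝ (α X k) x :=
  ((contDiffOn_of_mem_polyForms hS hα X k).differentiableOn (by simp)).differentiableAt
    (hU.mem_nhds hx)

theorem equivD_add_apply {α β : EForm V} {X : so V} {x : V}
    (hα : ∀ k, DifferentiableAt ℝ (α X k) x) (hβ : ∀ k, DifferentiableAt ℝ (β X k) x) (k : ℕ) :
    equivD (α + β) X k x = equivD α X k x + equivD β X k x := by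
  cases k with
  | zero =>
    ext v
    simp [equivD, deRham, contract]
    ring
  | succ k =>
    have h : extDeriv ((α + β) X k) x = extDeriv (α X k) x + extDeriv (β X k) x :=
      extDeriv_add (hα k) (hβ k)
    ext v
    simp only [equivD, deRham, contract, Pi.sub_apply, h]
    simp
    ring

theorem equivD_smul_apply (r : ℝ) (α : EForm V) (X : so V) (k : ℕ) (x : V) :
    equivD (r • α) X k x = r • equivD α X k x := by
  cases k with
  | zero =>
    ext v
    simp [equivD, deRham, contract]
  | succ k =>
    have h : extDeriv ((r • α) X k) x = r • extDeriv (α X k) x := extDeriv_smul r (α X k)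
    ext v
    simp only [equivD, deRham, contract, Pi.sub_apply, h]
    simp
    ring

/-- The equivariant differential as a linear map on a space `A` of equivariant forms that are
differentiable on the open set `U`. -/
def diffOn (U : Set V) (A : Submodule ℝ (EForm V))
    (hA : ∀ α ∈ A, ∀ X k, ∀ x ∈ U, DifferentiableAt ℝ (α X k) x) : A →ₗ[ℝ] EForm V where
  toFun α := fun X => res U (equivD (α : EForm V) X)
  map_add' a c := by
    funext X k x
    by_cases hx : x ∈ U
    · simp only [res, indicator_of_mem hx, Pi.add_apply, Submodule.coe_add]
      exact equivD_add_apply (fun k => hA _ a.2 X k x hx) (fun k => hA _ c.2 X k x hx) k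
    · simp [res, indicator_of_notMem hx]
  map_smul' r a := by
    funext X k x
    by_cases hx : x ∈ U
    · simp only [res, indicator_of_mem hx, Pi.smul_apply, Submodule.coe_smul, RingHom.id_apply]
      exact equivD_smul_apply r _ X k x
    · simp [res, indicator_of_notMem hx]

variable (V) in
/-- `D` on `𝒜_c^pol(𝔰𝔬(V), V)`. -/
def DC : ApolC V →ₗ[ℝ] EForm V := diffOn univ (ApolC V) fun _ hα X k x _ =>
  differentiableAt_of_mem_polyForms isOpen_univ (fun _ hθ k => (hθ k).1.contDiffOn) hα.1 X k
    (mem_univ x)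

variable (V) in
/-- `D` on `𝒜_dec-rap^pol(𝔰𝔬(V), V)`. -/
def DDR : ApolDR V →ₗ[ℝ] EForm V := diffOn univ (ApolDR V) fun _ hα X k x _ =>
  differentiableAt_of_mem_polyForms isOpen_univ (fun _ hθ k => (hθ k).1) hα.1.1 X k (mem_univ x)

variable (V) in
/-- `D` on `𝒜^pol(𝔰𝔬(V), U)`. -/
def DU (U : Set V) (hU : IsOpen U) : Apol V U →ₗ[ℝ] EForm V := diffOn U (Apol V U)
  fun _ hα X k _ hx => differentiableAt_of_mem_polyForms hU (fun _ hθ k => (hθ k).1) hα.1 X k hx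

variable (V) in
/-- The relative differential `D_rel(α, β) = (Dα, α|_{V ∖ {0}} - Dβ)`. -/
def DRel : ApolRel V →ₗ[ℝ] EForm V × EForm V :=
  ((DU V univ isOpen_univ).comp (relFst V)).prod
    ((resMap {0}ᶜ).comp ((Apol V univ).subtype.comp (relFst V))
      - (DU V {0}ᶜ isOpen_compl_singleton).comp (relSnd V))

/-- The cohomology `Ker D / Im D` of a complex `A` with differential `D`. -/
abbrev Cohomology {E : Type*} [AddCommGroup E] [Module ℝ E] {A : Submodule ℝ E}
    (D : A →ₗ[ℝ] E) : Type _ :=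
  LinearMap.ker D ⧸ (LinearMap.range D).comap (A.subtype ∘ₗ (LinearMap.ker D).subtype)

/-! ### Cut-off functions, integration, Thom forms and Thom classes -/

/-- `χ` is smooth, `SO(V)`-invariant, compactly supported, and equal to `1` near `0`. -/
structure IsCutoff (χ : V → ℝ) : Prop where
  contDiff : ContDiff ℝ ∞ χ
  hasCompactSupport : HasCompactSupport χ
  invariant : ∀ g ∈ SO V, ∀ x, χ (g x) = χ x
  eventually_eq_one : ∀ᶠ x in 𝓝 (0 : V), χ x = 1

variable (V) in
theorem exists_isCutoff [FiniteDimensional ℝ V] : ∃ χ : V → ℝ, IsCutoff χ := by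
  refine ⟨fun x => Real.smoothTransition (2 - ‖x‖ ^ 2), ?_, ?_, ?_, ?_⟩
  · exact Real.smoothTransition.contDiff.comp (contDiff_const.sub (contDiff_norm_sq ℝ))
  · refine HasCompactSupport.of_support_subset_isCompact (isCompact_closedBall (0 : V) 2) ?_
    intro x hx
    by_contra hx'
    have h2 : 2 < ‖x‖ := by simpa using hx'
    exact hx (Real.smoothTransition.zero_of_nonpos (by nlinarith))
  · intro g _ x
    simp only [LinearIsometryEquiv.norm_map]
  · filter_upwards [Metric.ball_mem_nhds (0 : V) one_pos] with x hx
    have h1 : ‖x‖ < 1 := by simpa using hx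
    exact Real.smoothTransition.one_of_one_le (by nlinarith [norm_nonneg x])

/-- The form `χ α + dχ ∧ β` on `V`, for `α` on `V` and `β` on `V ∖ {0}`. -/
def cutoffForm (χ : V → ℝ) (α β : EForm V) : EForm V
  | X, 0 => fun x => χ x • α X 0 x
  | X, k + 1 => fun x => χ x • α X (k + 1) x + wedgeOne (fderiv ℝ χ x) (β X k x)

/-- The integral `∫_V θ` of a form of mixed degree, for the orientation of `V` given by
`dx₁ ∧ ⋯ ∧ dx_d`: the Lebesgue integral of the coefficient of `dx₁ ∧ ⋯ ∧ dx_d` in `θ`. -/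
def formIntegral [FiniteDimensional ℝ V] [MeasurableSpace V] [BorelSpace V] {d : ℕ}
    (b : OrthonormalBasis (Fin d) ℝ V) (θ : MForm V) : ℝ := ∫ x : V, θ d x b

/-! ### Exterior algebras, the Berezin integral, and the forms of the theorem -/

/-- The sum `∑ aⁿ / n!` of the exponential series in a finite-dimensional real algebra, for the
canonical topology of a finite-dimensional real vector space. -/
def algExp {A : Type*} [Ring A] [Algebra ℝ A] (a : A) : A :=
  letI : TopologicalSpace A := moduleTopology ℝ A
  ∑' n : ℕ, ((n.factorial : ℝ)⁻¹) • a ^ n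

/-- The alternating form `(v₁, …, v_k) ↦ det (φᵢ(vⱼ))` attached to `φ₁, …, φ_k` in `V*`. -/
def detForm [FiniteDimensional ℝ V] {k : ℕ} (φ : Fin k → Module.Dual ℝ V) :
    V [⋀^Fin k]→L[ℝ] ℝ :=
  { Matrix.detRowAlternating.compLinearMap (LinearMap.pi φ) with
    cont := by
      change Continuous fun v : Fin k → V => Matrix.det fun j i => φ i (v j)
      exact Continuous.matrix_det (continuous_pi fun j => continuous_pi fun i =>
        (φ i).continuous_of_finiteDimensional.comp (continuous_apply j)) }

theorem detForm_apply [FiniteDimensional ℝ V] {k : ℕ} (φ : Fin k → Module.Dual ℝ V)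
    (v : Fin k → V) : detForm φ v = Matrix.det (Matrix.of fun i j => φ i (v j)) :=
  (Matrix.det_transpose (Matrix.of fun i j => φ i (v j)))

variable (V) in
/-- `φ₁, …, φ_k ↦ (v₁, …, v_k) ↦ det (φᵢ(vⱼ))`, as an alternating map. -/
def detFormAlt [FiniteDimensional ℝ V] (k : ℕ) :
    Module.Dual ℝ V [⋀^Fin k]→ₗ[ℝ] (V [⋀^Fin k]→L[ℝ] ℝ) where
  toFun := detForm
  map_update_add' := by
    intro inst φ i p q
    obtain rfl : inst = instDecidableEqFin k := Subsingleton.elim _ _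
    ext v
    rw [ContinuousAlternatingMap.add_apply]
    simp only [detForm_apply]
    have h : ∀ ψ : Module.Dual ℝ V, (Matrix.of fun a j => Function.update φ i ψ a (v j))
        = Matrix.updateRow (Matrix.of fun a j => φ a (v j)) i fun j => ψ (v j) := by
      intro ψ
      ext a j
      by_cases ha : a = i
      · subst ha
        simp
      · simp [ha]
    rw [h, h, h, ← Matrix.det_updateRow_add]
    rfl
  map_update_smul' := by
    intro inst φ i c p
    obtain rfl : inst = instDecidableEqFin k := Subsingleton.elim _ _
    ext v
    rw [ContinuousAlternatingMap.smul_apply]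
    simp only [detForm_apply]
    have h : ∀ ψ : Module.Dual ℝ V, (Matrix.of fun a j => Function.update φ i ψ a (v j))
        = Matrix.updateRow (Matrix.of fun a j => φ a (v j)) i fun j => ψ (v j) := by
      intro ψ
      ext a j
      by_cases ha : a = i
      · subst ha
        simp
      · simp [ha]
    rw [h, h, smul_eq_mul, ← Matrix.det_updateRow_smul]
    rfl
  map_eq_zero_of_eq' φ i j hij hne := by
    ext v
    rw [detForm_apply]
    exact Matrix.det_zero_of_row_eq hne (by
      ext a
      simp [hij])

variable (V) in
/-- The component of degree `k` of an element of `∧V*`, as an alternating form on `V`: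
`φ₁ ∧ ⋯ ∧ φ_k` is sent to `(v₁, …, v_k) ↦ det (φᵢ(vⱼ))`, and the other degrees to `0`. -/
def toForm [FiniteDimensional ℝ V] (k : ℕ) :
    ExteriorAlgebra ℝ (Module.Dual ℝ V) →ₗ[ℝ] (V [⋀^Fin k]→L[ℝ] ℝ) :=
  ExteriorAlgebra.liftAlternating
    (Pi.single (M := fun i => Module.Dual ℝ V [⋀^Fin i]→ₗ[ℝ] (V [⋀^Fin k]→L[ℝ] ℝ)) k
      (detFormAlt V k))

variable (V) in
/-- The super-algebra `∧V* ⊗ ∧V`, with the product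
`(α ⊗ ξ)(β ⊗ η) = (-1)^{|ξ||β|} αβ ⊗ ξη`. It is the fibre of `𝒜(V) ⊗ ∧V` at each point of `V`. -/
abbrev SuperAlg := GradedTensorProduct ℝ
  (fun i : ℕ => ⋀[ℝ]^i (Module.Dual ℝ V)) (fun i : ℕ => ⋀[ℝ]^i V)

section Berezin

variable {d : ℕ} (b : OrthonormalBasis (Fin d) ℝ V)

/-- The Berezin integral `T : ∧V → ℝ`: `T(e₁ ∧ ⋯ ∧ e_d) = 1`, and `T` vanishes on the
components of degree `≠ d`. -/
def berezin : ExteriorAlgebra ℝ V →ₗ[ℝ] ℝ :=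
  ExteriorAlgebra.liftAlternating
    (Pi.single (M := fun i => V [⋀^Fin i]→ₗ[ℝ] ℝ) d b.toBasis.det)

/-- The extension `T(α ⊗ ξ) = α T(ξ)` of the Berezin integral. -/
def berezinExt : SuperAlg V →ₗ[ℝ] ExteriorAlgebra ℝ (Module.Dual ℝ V) :=
  (TensorProduct.rid ℝ _).toLinearMap ∘ₗ LinearMap.lTensor _ (berezin b)
    ∘ₗ (GradedTensorProduct.of ℝ _ _).symm.toLinearMap

/-- `∑_{k<l} ⟨X e_k, e_l⟩ e_k ∧ e_l` in `∧V`. -/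
def twoVector (X : so V) : ExteriorAlgebra ℝ V :=
  ∑ k : Fin d, ∑ l ∈ Finset.Ioi k, ⟪(X : Module.End ℝ V) (b k), b l⟫_ℝ •
    (ExteriorAlgebra.ι ℝ (b k) * ExteriorAlgebra.ι ℝ (b l))

/-- The pfaffian `Pf(X) = T(exp(∑_{k<l} ⟨X e_k, e_l⟩ e_k ∧ e_l))`. -/
def pfaffian (X : so V) : ℝ := berezin b (algExp (twoVector b X))

/-- The value at `x` of
`f_t(X) = -t²‖x‖² + t ∑_k dx_k e_k + ½ ∑_{k<l} ⟨X e_k, e_l⟩ e_k ∧ e_l`. -/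
def fMap (t : ℝ) (X : so V) (x : V) : SuperAlg V :=
  algebraMap ℝ (SuperAlg V) (-(t ^ 2 * ‖x‖ ^ 2))
    + t • ∑ k : Fin d, GradedTensorProduct.tmul ℝ
        (ExteriorAlgebra.ι ℝ (b.toBasis.coord k)) (ExteriorAlgebra.ι ℝ (b k))
    + (1 / 2 : ℝ) • GradedTensorProduct.tmul ℝ 1 (twoVector b X)

/-- The value at `x` of `∑_k x_k e_k`. -/
def xMap (x : V) : SuperAlg V :=
  ∑ k : Fin d, b.toBasis.coord k x • GradedTensorProduct.tmul ℝ 1 (ExteriorAlgebra.ι ℝ (b k))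

/-- The constant function `Pf(X/2)` on `V`, as an equivariant form. -/
def pfForm : EForm V
  | X, 0 => fun _ => ContinuousAlternatingMap.constOfIsEmpty ℝ V (Fin 0)
      (pfaffian b ((1 / 2 : ℝ) • X))
  | _, _ + 1 => 0

variable [FiniteDimensional ℝ V]

/-- `C_∧^t(X) = T(exp(f_t(X)))`. -/
def cForm (t : ℝ) : EForm V := fun X k x => toForm V k (berezinExt b (algExp (fMap b t X x)))

/-- `η_∧^t(X) = -T((∑_k x_k e_k) exp(f_t(X)))`. -/
def etaForm (t : ℝ) : EForm V := fun X k x =>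
  toForm V k (-berezinExt b (xMap b x * algExp (fMap b t X x)))

/-- `β_∧(X) = ∫_0^∞ η_∧^t(X) dt`, a form on `V ∖ {0}`. -/
def betaForm : EForm V := fun X => res {0}ᶜ fun k x => ∫ t in Ioi (0 : ℝ), etaForm b t X k x

end Berezin

/-- `ε_d = (-1)^{d(d-1)/2} π^{d/2}`. -/
def eps (d : ℕ) : ℝ := (-1) ^ (d * (d - 1) / 2) * Real.pi ^ ((d : ℝ) / 2)

section Thom

variable [FiniteDimensional ℝ V] {d : ℕ} (b : OrthonormalBasis (Fin d) ℝ V)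

/-- `Th_rel(V) = ε_d⁻¹ (Pf(X/2), β_∧(X))`. -/
def ThRel : EForm V × EForm V := (eps d)⁻¹ • (pfForm b, betaForm b)

/-- `Th_c(V) = ε_d⁻¹ (χ Pf(X/2) + dχ ∧ β_∧(X))`. -/
def ThC (χ : V → ℝ) : EForm V := (eps d)⁻¹ • cutoffForm χ (pfForm b) (betaForm b)

/-- `Th_MQ(V) = ε_d⁻¹ T(exp(f_1(X)))`. -/
def ThMQ : EForm V := (eps d)⁻¹ • cForm b 1

variable [MeasurableSpace V] [BorelSpace V]

/-- The integral over `V` of a closed compactly supported form is `1`. -/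
def IsThomFormC (z : LinearMap.ker (DC V)) : Prop :=
  ∀ X, formIntegral b ((z : ApolC V).1 X) = 1

/-- The integral over `V` of a closed rapidly decreasing form is `1`. -/
def IsThomFormDR (z : LinearMap.ker (DDR V)) : Prop :=
  ∀ X, formIntegral b ((z : ApolDR V).1 X) = 1

/-- The integral over `V` of a relatively closed pair `(α, β)` is `1`. This integral is the one of
`χ α + dχ ∧ β`, for any cut-off function `χ`. -/
def IsThomFormRel (z : LinearMap.ker (DRel V)) : Prop :=
  ∀ χ : V → ℝ, IsCutoff χ → ∀ X,
    formIntegral b (cutoffForm χ (z : ApolRel V).1.1 (z : ApolRel V).1.2 X) = 1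

/-- A Thom class in a cohomology space: the class of a Thom form. -/
def IsThomClass {E : Type*} [AddCommGroup E] [Module ℝ E] {A : Submodule ℝ E} {D : A →ₗ[ℝ] E}
    (IsThomForm : LinearMap.ker D → Prop) (c : Cohomology D) : Prop :=
  ∃ z, IsThomForm z ∧ Submodule.Quotient.mk z = c

/-- `a` belongs to the complex `A`, is closed and is a Thom form, and its cohomology class is a
Thom class. -/
def IsThom {E : Type*} [AddCommGroup E] [Module ℝ E] {A : Submodule ℝ E} {D : A →ₗ[ℝ] E}
    (IsThomForm : LinearMap.ker D → Prop) (a : E) : Prop :=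
  ∃ z : LinearMap.ker D, (z : A).1 = a ∧ IsThomForm z ∧
    IsThomClass IsThomForm (Submodule.Quotient.mk z : Cohomology D)

end Thom

end EquivariantThom

end

open EquivariantThom

/-!
The three forms are governed by the constant forms `C_k(X) = thomCoeff b X k`, the components of
`T(exp(∑ dx_k e_k + ½ X̂))`, where `X̂ = ∑_{k<l} ⟨X e_k, e_l⟩ e_k ∧ e_l`. Apart from the scalar
`-t²‖x‖²`, the exponent `f_t(X)` is nilpotent, so its exponential is a finite sum, and counting
degrees gives
`C_∧^t = ∑ exp(-t²‖x‖²) t^k C_k` and `η_∧^t = -∑ exp(-t²‖x‖²) t^k ι(x) C_{k+1}` (`cForm_eq`,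
`etaForm_eq`). The integral over `t` is a Gamma integral. It converges for `x ≠ 0`, and the
component of degree `k` of `β_∧` is `-½ Γ((k+1)/2) ‖x‖^{-(k+1)} ι(x) C_{k+1}` (`betaForm_eq`). Moreover
`C_0(X) = Pf(X/2)`, and `C_d(X) = (-1)^{d(d-1)/2} dx₁ ∧ ⋯ ∧ dx_d` does not depend on `X`.

Closedness comes from one identity. The Berezin integral vanishes on contractions, and the
contraction of `exp(½ X̂)` with `x` is `½ (Xx) exp(½ X̂)`; together these say that
`ι(Xx) C_{k+2} = 2 ⟨x, ·⟩ ∧ C_k` and `ι(Xx) C_1 = 0` (`wedgeOne_thomCoeff`,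
`thomCoeff_one_curryLeft`). With `d(ι(x) C_{k+1}) = (k+1) C_{k+1}` and the functional equation of
`Γ`, it follows that `D(exp(-‖x‖²) ∑ C_k) = 0` and `D β_∧ = Pf(X/2)` away from `0` (`equivD_cForm`,
`equivD_betaForm`). The form `χ Pf(X/2) + dχ ∧ β_∧` is closed as well, since `dχ` vanishes on the
vector field `VX`, whose flow consists of rotations. Polynomiality in `X` and equivariance hold for
the `C_k` (`mem_polyForms_of_thomCoeff`, `thomCoeff_Ad`) and pass to forms built linearly from them.

For the integrals, the top-degree part of the Gaussian form is
`(-1)^{d(d-1)/2} exp(-‖x‖²) dx₁ ∧ ⋯ ∧ dx_d`, with integral `ε_d`. The top-degree part of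
`χ Pf(X/2) + dχ ∧ β_∧` is a multiple of `‖x‖^{-d} dχ(x)(x)`. In polar coordinates its integral over
each ray is `∫₀^∞ (d/dr) χ(rθ) dr = -1`, and the area of the sphere is again expressed by the
Gaussian integral, so the result is `ε_d` too (`formIntegral_cForm`, `formIntegral_cutoffForm`).
In dimension `0` there are no rays, and `V` is a point at which `χ = 1`.
-/

namespace EquivariantThom

open CliffordAlgebra (contractLeft)
open ContinuousAlternatingMap (alternatizeUncurryFinCLM alternatizeUncurryFin)

/-! ### The exponential of a scalar plus a nilpotent element -/

theorem t2Space_moduleTopology (A : Type*) [AddCommGroup A] [Module ℝ A] :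
    @T2Space A (moduleTopology ℝ A) := by
  let _ : TopologicalSpace A := moduleTopology ℝ A
  have : IsModuleTopology ℝ A := ⟨rfl⟩
  refine ⟨fun x y hxy => ?_⟩
  obtain ⟨f, hf⟩ : ∃ f : Module.Dual ℝ A, f x ≠ f y := by
    by_contra! h
    refine hxy (sub_eq_zero.1 ((Module.forall_dual_apply_eq_zero_iff ℝ (x - y)).1 fun f => ?_))
    rw [map_sub, h f, sub_self]
  exact separated_by_continuous (IsModuleTopology.continuous_of_linearMap f) hf

/-- The sum of the first `M` terms of the exponential series of `a`. -/
noncomputable def truncExp {A : Type*} [Ring A] [Algebra ℝ A] (M : ℕ) (a : A) : A :=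
  ∑ n ∈ Finset.range M, ((n.factorial : ℝ)⁻¹) • a ^ n

/-- For a nilpotent `a`, the exponential series of `r + a` sums to `e^r ∑_{n<M} aⁿ / n!`. -/
theorem algExp_algebraMap_add {A : Type*} [Ring A] [Algebra ℝ A] (r : ℝ) {a : A} {M : ℕ}
    (ha : a ^ M = 0) : algExp (algebraMap ℝ A r + a) = Real.exp r • truncExp M a := by
  let _ : TopologicalSpace A := moduleTopology ℝ A
  have : IsModuleTopology ℝ A := ⟨rfl⟩
  have : T2Space A := t2Space_moduleTopology A
  have : ContinuousAdd A := IsModuleTopology.toContinuousAdd ℝ A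
  have : ContinuousSMul ℝ A := IsModuleTopology.toContinuousSMul ℝ A
  have hexp : HasSum (fun n : ℕ => (n.factorial : ℝ)⁻¹ * r ^ n) (Real.exp r) := by
    have := NormedSpace.expSeries_div_hasSum_exp (𝔸 := ℝ) r
    rw [← Real.exp_eq_exp_ℝ] at this
    simpa [div_eq_inv_mul] using this
  have hterm : ∀ i : ℕ, HasSum (fun n : ℕ => if i ≤ n then
      ((((n - i).factorial : ℝ)⁻¹ * r ^ (n - i)) * (i.factorial : ℝ)⁻¹) • a ^ i else 0)
      (Real.exp r • ((i.factorial : ℝ)⁻¹ • a ^ i)) := by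
    intro i
    have h := (hexp.mul_right ((i.factorial : ℝ)⁻¹)).smul_const (a ^ i)
    rw [smul_smul]
    refine (Function.Injective.hasSum_iff (add_left_injective i) ?_).1 ?_
    · intro n hn
      rw [if_neg]
      intro hin
      exact hn ⟨n - i, Nat.sub_add_cancel hin⟩
    · simpa [Function.comp_def] using h
  have hsum := hasSum_sum (s := Finset.range M) fun i _ => hterm i
  have key : ∀ n : ℕ, ((n.factorial : ℝ)⁻¹) • (algebraMap ℝ A r + a) ^ n =
      ∑ i ∈ Finset.range M, if i ≤ n then
      ((((n - i).factorial : ℝ)⁻¹ * r ^ (n - i)) * (i.factorial : ℝ)⁻¹) • a ^ i else 0 := by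
    intro n
    rw [add_comm, (show Commute a _ from (Algebra.commutes r a).symm).add_pow, Finset.smul_sum]
    have h1 : ∀ i ∈ Finset.range (n + 1), ((n.factorial : ℝ)⁻¹) •
        (a ^ i * algebraMap ℝ A r ^ (n - i) * (n.choose i : A)) = if i ≤ n then
      ((((n - i).factorial : ℝ)⁻¹ * r ^ (n - i)) * (i.factorial : ℝ)⁻¹) • a ^ i else 0 := by
      intro i hi
      have hin : i ≤ n := Nat.lt_succ_iff.1 (Finset.mem_range.1 hi)
      rw [if_pos hin, ← map_pow, ← Algebra.commutes, ← Algebra.smul_def, ← nsmul_eq_mul',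
        ← Nat.cast_smul_eq_nsmul ℝ, smul_smul, smul_smul, Nat.cast_choose ℝ hin]
      congr 1
      have := Nat.factorial_ne_zero n
      field_simp
    rw [Finset.sum_congr rfl h1]
    -- both sums equal the one over `range (max (n + 1) M)`
    have h2 : ∀ K, n + 1 ≤ K → ∑ i ∈ Finset.range (n + 1), (if i ≤ n then
      ((((n - i).factorial : ℝ)⁻¹ * r ^ (n - i)) * (i.factorial : ℝ)⁻¹) • a ^ i else 0)
      = ∑ i ∈ Finset.range K, (if i ≤ n then
      ((((n - i).factorial : ℝ)⁻¹ * r ^ (n - i)) * (i.factorial : ℝ)⁻¹) • a ^ i else 0) := by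
      intro K hK
      refine Finset.sum_subset (Finset.range_subset_range.2 hK) fun i _ hi => if_neg ?_
      simpa using hi
    have h3 : ∀ K, M ≤ K → ∑ i ∈ Finset.range M, (if i ≤ n then
      ((((n - i).factorial : ℝ)⁻¹ * r ^ (n - i)) * (i.factorial : ℝ)⁻¹) • a ^ i else 0)
      = ∑ i ∈ Finset.range K, (if i ≤ n then
      ((((n - i).factorial : ℝ)⁻¹ * r ^ (n - i)) * (i.factorial : ℝ)⁻¹) • a ^ i else 0) := by
      intro K hK
      refine Finset.sum_subset (Finset.range_subset_range.2 hK) fun i _ hi => ?_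
      rw [pow_eq_zero_of_le (by simpa using hi) ha, smul_zero, ite_self]
    rw [h2 _ (le_max_left _ M), h3 _ (le_max_right (n + 1) _)]
  have : algExp (algebraMap ℝ A r + a) = ∑' n : ℕ, ∑ i ∈ Finset.range M, if i ≤ n then
      ((((n - i).factorial : ℝ)⁻¹ * r ^ (n - i)) * (i.factorial : ℝ)⁻¹) • a ^ i else 0 :=
    tsum_congr key
  rw [this, hsum.tsum_eq, truncExp, Finset.smul_sum]

theorem algExp_eq_truncExp {A : Type*} [Ring A] [Algebra ℝ A] {a : A} {M : ℕ}
    (ha : a ^ M = 0) : algExp a = truncExp M a := by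
  simpa using algExp_algebraMap_add 0 ha

theorem sum_pow_card_succ_eq_zero {A ι : Type*} [Ring A] (s : Finset ι) (f : ι → A)
    (hf : ∀ i ∈ s, f i ^ 2 = 0) (hc : ∀ i ∈ s, ∀ j ∈ s, Commute (f i) (f j)) :
    (∑ i ∈ s, f i) ^ (s.card + 1) = 0 := by
  classical
  induction s using Finset.induction_on with
  | empty => simp
  | insert i s hi ih =>
    rw [Finset.sum_insert hi, Finset.card_insert_of_notMem hi]
    refine Commute.add_pow_eq_zero_of_add_le_succ_of_pow_eq_zero
      (Commute.sum_right _ _ _ fun j hj => hc i (Finset.mem_insert_self _ _) j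
        (Finset.mem_insert_of_mem hj)) (hf i (Finset.mem_insert_self _ _))
      (ih (fun j hj => hf j (Finset.mem_insert_of_mem hj)) fun j hj k hk =>
        hc j (Finset.mem_insert_of_mem hj) k (Finset.mem_insert_of_mem hk)) (by omega)

theorem truncExp_eq_of_le {A : Type*} [Ring A] [Algebra ℝ A] {a : A} {M K : ℕ}
    (ha : a ^ M = 0) (hMK : M ≤ K) : truncExp K a = truncExp M a := by
  refine (Finset.sum_subset (Finset.range_subset_range.2 hMK) fun i _ hi => ?_).symm
  rw [pow_eq_zero_of_le (by simpa using hi) ha, smul_zero]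

/-! ### Contractions in an exterior algebra -/

section Exterior

variable {M : Type*} [AddCommGroup M] [Module ℝ M]

theorem contractLeft_ι_mul' (φ : Module.Dual ℝ M) (a : M) (B : ExteriorAlgebra ℝ M) :
    contractLeft φ (ExteriorAlgebra.ι ℝ a * B)
      = φ a • B - ExteriorAlgebra.ι ℝ a * contractLeft φ B :=
  CliffordAlgebra.contractLeft_ι_mul φ a B

theorem ιMulti_succ_mul (n : ℕ) (v : Fin (n + 1) → M) (B : ExteriorAlgebra ℝ M) :
    ExteriorAlgebra.ιMulti ℝ (n + 1) v * B
      = ExteriorAlgebra.ι ℝ (v 0) * (ExteriorAlgebra.ιMulti ℝ n (fun i => v i.succ) * B) := by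
  rw [ExteriorAlgebra.ιMulti_succ_apply, mul_assoc]
  rfl

/-- The contraction is an antiderivation, expanded over the factors of `v₀ ∧ ⋯ ∧ v_n ∧ B`. -/
theorem contractLeft_ιMulti_mul (φ : Module.Dual ℝ M) (n : ℕ) (v : Fin (n + 1) → M)
    (B : ExteriorAlgebra ℝ M) :
    contractLeft φ (ExteriorAlgebra.ιMulti ℝ (n + 1) v * B)
      = ∑ i : Fin (n + 1), ((-1 : ℝ) ^ (i : ℕ) * φ (v i)) •
          (ExteriorAlgebra.ιMulti ℝ n (i.removeNth v) * B)
        + (-1 : ℝ) ^ (n + 1) • (ExteriorAlgebra.ιMulti ℝ (n + 1) v * contractLeft φ B) := by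
  induction n with
  | zero =>
    rw [ιMulti_succ_mul, contractLeft_ι_mul', ιMulti_succ_mul]
    simp [sub_eq_add_neg]
  | succ n ih =>
    rw [ιMulti_succ_mul, contractLeft_ι_mul', ih, Fin.sum_univ_succ (n := n + 1),
      ιMulti_succ_mul (n + 1) v]
    simp only [Fin.val_zero, pow_zero, one_mul, Fin.removeNth_zero, Fin.val_succ, mul_add,
      Finset.mul_sum, mul_smul_comm]
    have h : ∀ i : Fin (n + 1), ExteriorAlgebra.ιMulti ℝ (n + 1) (i.succ.removeNth v) * B
        = ExteriorAlgebra.ι ℝ (v 0)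
          * (ExteriorAlgebra.ιMulti ℝ n (i.removeNth fun j => v j.succ) * B) := by
      intro i
      rw [ιMulti_succ_mul]
      have e : (fun j : Fin n => (i.succ.removeNth v) j.succ)
          = i.removeNth fun j : Fin (n + 1) => v j.succ := by
        ext j
        simp [Fin.removeNth_apply]
      rw [e]
      simp [Fin.removeNth_apply]
    simp only [h, pow_succ, neg_smul, mul_neg, mul_one, neg_mul, Finset.sum_neg_distrib]
    simp only [Fin.tail_def]
    module

theorem contractLeft_ιMulti (φ : Module.Dual ℝ M) (n : ℕ) (v : Fin (n + 1) → M) :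
    contractLeft φ (ExteriorAlgebra.ιMulti ℝ (n + 1) v)
      = ∑ i : Fin (n + 1), ((-1 : ℝ) ^ (i : ℕ) * φ (v i)) •
          ExteriorAlgebra.ιMulti ℝ n (i.removeNth v) := by
  have h := contractLeft_ιMulti_mul φ n v 1
  have h1 : contractLeft φ (1 : ExteriorAlgebra ℝ M) = 0 := CliffordAlgebra.contractLeft_one _ φ
  simpa [h1] using h

theorem mem_exteriorPower_induction {n : ℕ} {p : ExteriorAlgebra ℝ M → Prop}
    (h0 : p 0) (hadd : ∀ a c, p a → p c → p (a + c)) (hsmul : ∀ (r : ℝ) a, p a → p (r • a))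
    (hmul : ∀ v : Fin n → M, p (ExteriorAlgebra.ιMulti ℝ n v))
    {a : ExteriorAlgebra ℝ M} (ha : a ∈ ⋀[ℝ]^n M) : p a := by
  rw [← ExteriorAlgebra.ιMulti_span_fixedDegree] at ha
  induction ha using Submodule.span_induction with
  | mem a ha => obtain ⟨v, rfl⟩ := ha; exact hmul v
  | zero => exact h0
  | add a c _ _ ha hc => exact hadd a c ha hc
  | smul r a _ ha => exact hsmul r a ha

theorem contractLeft_mem_exteriorPower (φ : Module.Dual ℝ M) {n : ℕ} {a : ExteriorAlgebra ℝ M}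
    (ha : a ∈ ⋀[ℝ]^(n + 1) M) : contractLeft φ a ∈ ⋀[ℝ]^n M := by
  refine mem_exteriorPower_induction (p := fun a => contractLeft φ a ∈ ⋀[ℝ]^n M) ?_ ?_ ?_ ?_ ha
  · simp
  · intro a c ha hc
    rw [map_add]
    exact Submodule.add_mem _ ha hc
  · intro r a ha
    rw [map_smul]
    exact Submodule.smul_mem _ r ha
  · intro v
    rw [contractLeft_ιMulti]
    exact Submodule.sum_mem _ fun i _ => Submodule.smul_mem _ _
      (ExteriorAlgebra.ιMulti_range ℝ n ⟨_, rfl⟩)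

theorem contractLeft_of_mem_exteriorPower_zero (φ : Module.Dual ℝ M) {a : ExteriorAlgebra ℝ M}
    (ha : a ∈ ⋀[ℝ]^0 M) : contractLeft φ a = 0 := by
  refine mem_exteriorPower_induction (p := fun a => contractLeft φ a = 0) ?_ ?_ ?_ ?_ ha
  · simp
  · intro a c ha hc
    rw [map_add, ha, hc, add_zero]
  · intro r a ha
    rw [map_smul, ha, smul_zero]
  · intro v
    rw [ExteriorAlgebra.ιMulti_zero_apply]
    exact CliffordAlgebra.contractLeft_one _ φ

theorem ι_mem_exteriorPower_one (m : M) : ExteriorAlgebra.ι ℝ m ∈ ⋀[ℝ]^1 M := by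
  simp

end Exterior

variable {V : Type*} [NormedAddCommGroup V] [InnerProductSpace ℝ V]

/-! ### The Berezin integral and evaluation of forms -/

section BerezinLemmas

variable {d : ℕ} (b : OrthonormalBasis (Fin d) ℝ V)

theorem berezin_ιMulti (v : Fin d → V) :
    berezin b (ExteriorAlgebra.ιMulti ℝ d v) = b.toBasis.det v := by
  rw [berezin, ExteriorAlgebra.liftAlternating_apply_ιMulti, Pi.single_eq_same]

theorem berezin_of_mem_exteriorPower {n : ℕ} (hn : n ≠ d) {a : ExteriorAlgebra ℝ V}
    (ha : a ∈ ⋀[ℝ]^n V) : berezin b a = 0 := by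
  refine mem_exteriorPower_induction (p := fun a => berezin b a = 0) ?_ ?_ ?_ ?_ ha
  · simp
  · intro a c ha hc
    rw [map_add, ha, hc, add_zero]
  · intro r a ha
    rw [map_smul, ha, smul_zero]
  · intro v
    rw [berezin, ExteriorAlgebra.liftAlternating_apply_ιMulti, Pi.single_eq_of_ne hn]
    rfl

theorem ιMulti_eq_zero_of_basis (b : OrthonormalBasis (Fin d) ℝ V) {n : ℕ} (hn : d < n)
    (v : Fin n → V) : ExteriorAlgebra.ιMulti ℝ n v = 0 := by
  refine AlternatingMap.map_linearDependent _ _ fun h => ?_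
  have : FiniteDimensional ℝ V := Module.Basis.finiteDimensional_of_finite b.toBasis
  have h1 := h.fintype_card_le_finrank
  rw [Module.finrank_eq_card_basis b.toBasis, Fintype.card_fin, Fintype.card_fin] at h1
  omega

/-- The Berezin integral of a contraction vanishes: a contraction has no component of top
degree. -/
theorem berezin_contractLeft (φ : Module.Dual ℝ V) (a : ExteriorAlgebra ℝ V) :
    berezin b (contractLeft φ a) = 0 := by
  have h : berezin b ∘ₗ contractLeft φ = (0 : ExteriorAlgebra ℝ V →ₗ[ℝ] ℝ) := by
    refine ExteriorAlgebra.lhom_ext fun n => ?_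
    ext v
    change berezin b (contractLeft φ (ExteriorAlgebra.ιMulti ℝ n v)) = 0
    have hv : ExteriorAlgebra.ιMulti ℝ n v ∈ ⋀[ℝ]^n V :=
      ExteriorAlgebra.ιMulti_range ℝ n ⟨v, rfl⟩
    cases n with
    | zero => rw [contractLeft_of_mem_exteriorPower_zero φ hv, map_zero]
    | succ n =>
      by_cases hn : n = d
      · rw [ιMulti_eq_zero_of_basis b (by omega), map_zero, map_zero]
      · exact berezin_of_mem_exteriorPower b hn (contractLeft_mem_exteriorPower φ hv)
  exact LinearMap.congr_fun h a

end BerezinLemmas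

section ToForm

variable [FiniteDimensional ℝ V]

theorem toForm_ιMulti (k : ℕ) (φ : Fin k → Module.Dual ℝ V) :
    toForm V k (ExteriorAlgebra.ιMulti ℝ k φ) = detForm φ := by
  rw [toForm, ExteriorAlgebra.liftAlternating_apply_ιMulti, Pi.single_eq_same]
  rfl

theorem toForm_of_mem_exteriorPower {n k : ℕ} (hn : n ≠ k)
    {a : ExteriorAlgebra ℝ (Module.Dual ℝ V)} (ha : a ∈ ⋀[ℝ]^n (Module.Dual ℝ V)) :
    toForm V k a = 0 := by
  refine mem_exteriorPower_induction (p := fun a => toForm V k a = 0) ?_ ?_ ?_ ?_ ha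
  · simp
  · intro a c ha hc
    rw [map_add, ha, hc, add_zero]
  · intro r a ha
    rw [map_smul, ha, smul_zero]
  · intro v
    rw [toForm, ExteriorAlgebra.liftAlternating_apply_ιMulti, Pi.single_eq_of_ne hn]
    rfl

/-- Inserting `v` in the first slot of a form is the contraction with `v` in `∧V*`. -/
theorem toForm_succ_apply (k : ℕ) (a : ExteriorAlgebra ℝ (Module.Dual ℝ V)) (v : V)
    (w : Fin k → V) : toForm V (k + 1) a (Matrix.vecCons v w)
      = toForm V k (contractLeft (Module.Dual.eval ℝ V v) a) w := by
  let L : (V [⋀^Fin (k + 1)]→L[ℝ] ℝ) →ₗ[ℝ] ℝ :=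
    { toFun := fun f => f (Matrix.vecCons v w)
      map_add' := fun _ _ => rfl
      map_smul' := fun _ _ => rfl }
  let L' : (V [⋀^Fin k]→L[ℝ] ℝ) →ₗ[ℝ] ℝ :=
    { toFun := fun f => f w
      map_add' := fun _ _ => rfl
      map_smul' := fun _ _ => rfl }
  have h : L ∘ₗ toForm V (k + 1) = L' ∘ₗ toForm V k ∘ₗ contractLeft (Module.Dual.eval ℝ V v) := by
    refine ExteriorAlgebra.lhom_ext fun n => ?_
    ext φ
    change toForm V (k + 1) (ExteriorAlgebra.ιMulti ℝ n φ) (Matrix.vecCons v w)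
      = toForm V k (contractLeft (Module.Dual.eval ℝ V v) (ExteriorAlgebra.ιMulti ℝ n φ)) w
    have hv : ExteriorAlgebra.ιMulti ℝ n φ ∈ ⋀[ℝ]^n (Module.Dual ℝ V) :=
      ExteriorAlgebra.ιMulti_range ℝ n ⟨φ, rfl⟩
    by_cases hn : n = k + 1
    · subst hn
      rw [toForm_ιMulti, detForm_apply, contractLeft_ιMulti, Matrix.det_succ_column_zero, map_sum,
        ContinuousAlternatingMap.sum_apply]
      refine Finset.sum_congr rfl fun i _ => ?_
      rw [map_smul, toForm_ιMulti, ContinuousAlternatingMap.smul_apply, detForm_apply]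
      rfl
    · rw [toForm_of_mem_exteriorPower hn hv]
      cases n with
      | zero =>
        rw [contractLeft_of_mem_exteriorPower_zero _ hv, map_zero]
        rfl
      | succ n =>
        rw [toForm_of_mem_exteriorPower (by omega) (contractLeft_mem_exteriorPower _ hv)]
        rfl
  exact LinearMap.congr_fun h a

theorem toForm_zero_one (w : Fin 0 → V) : toForm V 0 1 w = 1 := by
  rw [← ExteriorAlgebra.ιMulti_zero_apply (R := ℝ) (M := Module.Dual ℝ V) ![], toForm_ιMulti,
    detForm_apply, Matrix.det_isEmpty]

end ToForm

/-! ### The algebra `∧V* ⊗ ∧V` -/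

section Super

open GradedTensorProduct

theorem superAlg_tmul_mul_tmul {i j : ℕ} (α : ExteriorAlgebra ℝ (Module.Dual ℝ V))
    {ξ : ExteriorAlgebra ℝ V} (hξ : ξ ∈ ⋀[ℝ]^j V) {β : ExteriorAlgebra ℝ (Module.Dual ℝ V)}
    (hβ : β ∈ ⋀[ℝ]^i (Module.Dual ℝ V)) (η : ExteriorAlgebra ℝ V) :
    (tmul ℝ α ξ * tmul ℝ β η : SuperAlg V) = (-1 : ℝ) ^ (j * i) • tmul ℝ (α * β) (ξ * η) := by
  have h := tmul_coe_mul_coe_tmul (R := ℝ) (fun i : ℕ => ⋀[ℝ]^i (Module.Dual ℝ V))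
    (fun i : ℕ => ⋀[ℝ]^i V) α (⟨ξ, hξ⟩ : ⋀[ℝ]^j V) (⟨β, hβ⟩ : ⋀[ℝ]^i (Module.Dual ℝ V)) η
  refine h.trans ?_
  rw [Units.smul_def, ← Int.cast_smul_eq_zsmul ℝ]
  congr 1
  have e := uzpow_natCast (-1 : ℤˣ) (R := ℕ) (j * i)
  rw [Nat.cast_id] at e
  rw [e]
  push_cast
  rfl

theorem superAlg_one_tmul_mul_one_tmul (ξ η : ExteriorAlgebra ℝ V) :
    (tmul ℝ 1 ξ * tmul ℝ 1 η : SuperAlg V) = tmul ℝ 1 (ξ * η) :=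
  (map_mul (includeRight (R := ℝ) (fun i : ℕ => ⋀[ℝ]^i (Module.Dual ℝ V))
    (fun i : ℕ => ⋀[ℝ]^i V)) ξ η).symm

/-- Linear maps on `∧V* ⊗ ∧V` agree if they agree on the tensors `α ⊗ ξ` with `α` homogeneous. -/
theorem superAlg_hom_ext {N : Type*} [AddCommGroup N] [Module ℝ N] {f g : SuperAlg V →ₗ[ℝ] N}
    (h : ∀ (i : ℕ) (α : ExteriorAlgebra ℝ (Module.Dual ℝ V)), α ∈ ⋀[ℝ]^i (Module.Dual ℝ V) →
      ∀ ξ : ExteriorAlgebra ℝ V, f (tmul ℝ α ξ) = g (tmul ℝ α ξ)) : f = g := by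
  refine GradedTensorProduct.hom_ext _ _ (TensorProduct.ext' fun α ξ => ?_)
  change f (tmul ℝ α ξ) = g (tmul ℝ α ξ)
  refine DirectSum.Decomposition.inductionOn (fun i : ℕ => ⋀[ℝ]^i (Module.Dual ℝ V))
    (motive := fun α => f (tmul ℝ α ξ) = g (tmul ℝ α ξ)) ?_ ?_ ?_ α
  · simp [tmul]
  · intro i α
    exact h i α α.2 ξ
  · intro α β hα hβ
    simp only [tmul, TensorProduct.add_tmul, map_add] at hα hβ ⊢
    rw [hα, hβ]

/-- The contraction of the differential forms with `v`, extended to `∧V* ⊗ ∧V`. -/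
noncomputable def contractSuper (v : V) : SuperAlg V →ₗ[ℝ] SuperAlg V :=
  (of ℝ _ _).toLinearMap ∘ₗ LinearMap.rTensor (ExteriorAlgebra ℝ V)
    (contractLeft (Module.Dual.eval ℝ V v)) ∘ₗ (of ℝ _ _).symm.toLinearMap

theorem contractSuper_tmul (v : V) (α : ExteriorAlgebra ℝ (Module.Dual ℝ V))
    (ξ : ExteriorAlgebra ℝ V) :
    contractSuper v (tmul ℝ α ξ) = tmul ℝ (contractLeft (Module.Dual.eval ℝ V v) α) ξ := rfl

theorem contractSuper_one_tmul (v : V) (ξ : ExteriorAlgebra ℝ V) :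
    contractSuper v (tmul ℝ 1 ξ) = 0 := by
  rw [contractSuper_tmul]
  have : contractLeft (Module.Dual.eval ℝ V v) (1 : ExteriorAlgebra ℝ (Module.Dual ℝ V)) = 0 :=
    CliffordAlgebra.contractLeft_one _ _
  rw [this]
  simp [tmul]

/-- `ι(v)` is an antiderivation: it picks up the sign `(-1)^j` in front of `1 ⊗ η`, `|η| = j`. -/
theorem contractSuper_one_tmul_mul (v : V) {j : ℕ} {η : ExteriorAlgebra ℝ V}
    (hη : η ∈ ⋀[ℝ]^j V) (a : SuperAlg V) :
    contractSuper v (tmul ℝ 1 η * a) = (-1 : ℝ) ^ j • (tmul ℝ 1 η * contractSuper v a) := by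
  have h : contractSuper v ∘ₗ LinearMap.mulLeft ℝ (tmul ℝ 1 η : SuperAlg V)
      = (-1 : ℝ) ^ j • (LinearMap.mulLeft ℝ (tmul ℝ 1 η : SuperAlg V) ∘ₗ contractSuper v) := by
    refine superAlg_hom_ext fun i α hα ξ => ?_
    change contractSuper v (tmul ℝ 1 η * tmul ℝ α ξ)
      = (-1 : ℝ) ^ j • (tmul ℝ 1 η * contractSuper v (tmul ℝ α ξ))
    rw [superAlg_tmul_mul_tmul 1 hη hα, map_smul, contractSuper_tmul, contractSuper_tmul]
    cases i with
    | zero =>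
      rw [one_mul, contractLeft_of_mem_exteriorPower_zero _ hα]
      simp [tmul]
    | succ i =>
      rw [superAlg_tmul_mul_tmul 1 hη (contractLeft_mem_exteriorPower _ hα), smul_smul,
        one_mul, one_mul, ← pow_add]
      congr 2
      ring
  exact LinearMap.congr_fun h a

theorem contractSuper_ι_tmul_ι_mul (v : V) (φ : Module.Dual ℝ V) (e : V) (a : SuperAlg V) :
    contractSuper v (tmul ℝ (ExteriorAlgebra.ι ℝ φ) (ExteriorAlgebra.ι ℝ e) * a)
      = φ v • (tmul ℝ 1 (ExteriorAlgebra.ι ℝ e) * a)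
        + tmul ℝ (ExteriorAlgebra.ι ℝ φ) (ExteriorAlgebra.ι ℝ e) * contractSuper v a := by
  set p : SuperAlg V := tmul ℝ (ExteriorAlgebra.ι ℝ φ) (ExteriorAlgebra.ι ℝ e) with hp
  have he := ι_mem_exteriorPower_one e
  have h : contractSuper v ∘ₗ LinearMap.mulLeft ℝ p
      = φ v • LinearMap.mulLeft ℝ (tmul ℝ 1 (ExteriorAlgebra.ι ℝ e) : SuperAlg V)
        + LinearMap.mulLeft ℝ p ∘ₗ contractSuper v := by
    refine superAlg_hom_ext fun i α hα ξ => ?_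
    change contractSuper v (p * tmul ℝ α ξ)
      = φ v • (tmul ℝ 1 (ExteriorAlgebra.ι ℝ e) * tmul ℝ α ξ) + p * contractSuper v (tmul ℝ α ξ)
    rw [hp, superAlg_tmul_mul_tmul _ he hα, superAlg_tmul_mul_tmul _ he hα, map_smul,
      contractSuper_tmul, contractSuper_tmul, contractLeft_ι_mul']
    cases i with
    | zero =>
      rw [one_mul, contractLeft_of_mem_exteriorPower_zero _ hα]
      simp [tmul, ← TensorProduct.smul_tmul']
    | succ i =>
      rw [superAlg_tmul_mul_tmul _ he (contractLeft_mem_exteriorPower _ hα)]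
      simp only [tmul, TensorProduct.sub_tmul, map_sub, one_mul, pow_succ,
        ← TensorProduct.smul_tmul', map_smul, Module.Dual.eval_apply]
      module
  exact LinearMap.congr_fun h a

theorem ι_mul_ι_swap (e f : V) : ExteriorAlgebra.ι ℝ e * ExteriorAlgebra.ι ℝ f
    = -(ExteriorAlgebra.ι ℝ f * ExteriorAlgebra.ι ℝ e) :=
  eq_neg_of_add_eq_zero_left (ExteriorAlgebra.ι_add_mul_swap e f)

end Super

/-! ### The bivector of an antisymmetric endomorphism -/

theorem inner_so_left (X : so V) (u v : V) :
    ⟪(X : Module.End ℝ V) u, v⟫_ℝ = -⟪u, (X : Module.End ℝ V) v⟫_ℝ := by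
  have hX : (innerₗ V).IsSkewAdjoint (X : Module.End ℝ V) :=
    (LinearMap.mem_skewAdjointSubmodule _).1 X.2
  have h := hX u v
  simpa only [innerₗ_apply_apply, Pi.neg_apply, inner_neg_right] using h

theorem ιMulti_mul_ι (k : ℕ) (v : Fin k → V) (u : V) :
    ExteriorAlgebra.ιMulti ℝ k v * ExteriorAlgebra.ι ℝ u
      = (-1 : ℝ) ^ k • (ExteriorAlgebra.ι ℝ u * ExteriorAlgebra.ιMulti ℝ k v) := by
  induction k with
  | zero => simp
  | succ k ih =>
    have e := ιMulti_succ_mul k v 1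
    rw [mul_one, mul_one] at e
    rw [ιMulti_succ_mul, ih, e, mul_smul_comm, ← mul_assoc, ← mul_assoc, ι_mul_ι_swap (v 0) u,
      pow_succ]
    simp

theorem ι_mul_ι_mul_ι (e f v : V) :
    ExteriorAlgebra.ι ℝ v * (ExteriorAlgebra.ι ℝ e * ExteriorAlgebra.ι ℝ f)
      = ExteriorAlgebra.ι ℝ e * ExteriorAlgebra.ι ℝ f * ExteriorAlgebra.ι ℝ v := by
  rw [← mul_assoc, ι_mul_ι_swap v e, neg_mul, mul_assoc, ι_mul_ι_swap v f, mul_neg, neg_neg,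
    mul_assoc]

theorem commute_ι_mul_ι (e f e' f' : V) :
    Commute (ExteriorAlgebra.ι ℝ e * ExteriorAlgebra.ι ℝ f)
      (ExteriorAlgebra.ι ℝ e' * ExteriorAlgebra.ι ℝ f') := by
  rw [commute_iff_eq, ← mul_assoc, ← ι_mul_ι_mul_ι, mul_assoc _ _ (ExteriorAlgebra.ι ℝ f'),
    ← ι_mul_ι_mul_ι, ← mul_assoc]

theorem ι_mul_ι_sq (e f : V) : (ExteriorAlgebra.ι ℝ e * ExteriorAlgebra.ι ℝ f) ^ 2 = 0 := by
  rw [sq, mul_assoc, ι_mul_ι_mul_ι, ← mul_assoc, ← mul_assoc, ExteriorAlgebra.ι_sq_zero, zero_mul,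
    zero_mul]

section TwoVector

variable {d : ℕ} (b : OrthonormalBasis (Fin d) ℝ V)

theorem sum_sum_Ioi_of_symm {A : Type*} [AddCommGroup A] [Module ℝ A] (F : Fin d → Fin d → A)
    (hF : ∀ k l, F k l = F l k) (h0 : ∀ k, F k k = 0) :
    ∑ k, ∑ l ∈ Finset.Ioi k, F k l = (1 / 2 : ℝ) • ∑ k, ∑ l, F k l := by
  have h1 : ∀ k, ∑ l, F k l = ∑ l ∈ Finset.Ioi k, F k l + ∑ l ∈ Finset.Iio k, F k l := by
    intro k
    have : (Finset.univ : Finset (Fin d)) = insert k (Finset.Ioi k ∪ Finset.Iio k) := by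
      ext l
      simp only [Finset.mem_univ, Finset.mem_insert, Finset.mem_union, Finset.mem_Ioi,
        Finset.mem_Iio, true_iff]
      omega
    rw [this, Finset.sum_insert (by simp), h0, zero_add, Finset.sum_union]
    rw [Finset.disjoint_left]
    intro l hl
    simp only [Finset.mem_Ioi, Finset.mem_Iio] at hl ⊢
    omega
  have h2 : ∑ k, ∑ l ∈ Finset.Iio k, F k l = ∑ k, ∑ l ∈ Finset.Ioi k, F k l := by
    rw [Finset.sum_comm' (t' := Finset.univ) (s' := fun l => Finset.Ioi l) (by simp)]
    exact Finset.sum_congr rfl fun k _ => Finset.sum_congr rfl fun l _ => hF l k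
  rw [Finset.sum_congr rfl fun k _ => h1 k, Finset.sum_add_distrib, h2, ← two_smul ℝ, smul_smul]
  norm_num

/-- A formula for the bivector of `X` that does not involve the order of the basis. -/
theorem twoVector_eq (X : so V) : twoVector b X = (1 / 2 : ℝ) • ∑ k,
    ExteriorAlgebra.ι ℝ (b k) * ExteriorAlgebra.ι ℝ ((X : Module.End ℝ V) (b k)) := by
  rw [twoVector, sum_sum_Ioi_of_symm]
  · congr 1
    refine Finset.sum_congr rfl fun k _ => ?_
    conv_rhs => rw [← b.sum_repr' ((X : Module.End ℝ V) (b k)), map_sum, Finset.mul_sum]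
    refine Finset.sum_congr rfl fun l _ => ?_
    rw [map_smul, mul_smul_comm, real_inner_comm]
  · intro k l
    rw [inner_so_left, ι_mul_ι_swap, real_inner_comm]
    simp
  · intro k
    rw [ExteriorAlgebra.ι_sq_zero, smul_zero]

theorem twoVector_smul (r : ℝ) (X : so V) : twoVector b (r • X) = r • twoVector b X := by
  rw [twoVector_eq, twoVector_eq, smul_comm, Finset.smul_sum (r := r)]
  congr 1
  refine Finset.sum_congr rfl fun k _ => ?_
  simp

theorem twoVector_mem (X : so V) : twoVector b X ∈ ⋀[ℝ]^2 V :=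
  Submodule.sum_mem _ fun k _ => Submodule.sum_mem _ fun l _ => Submodule.smul_mem _ _
    (SetLike.mul_mem_graded (ι_mem_exteriorPower_one (b k)) (ι_mem_exteriorPower_one (b l)))

theorem ι_mul_twoVector (X : so V) (v : V) :
    ExteriorAlgebra.ι ℝ v * twoVector b X = twoVector b X * ExteriorAlgebra.ι ℝ v := by
  simp only [twoVector, Finset.mul_sum, Finset.sum_mul, mul_smul_comm, smul_mul_assoc,
    ι_mul_ι_mul_ι]

/-- The contraction of the bivector of `X` with `x` is the vector `Xx`. -/
theorem contractLeft_twoVector_mul (X : so V) (x : V) (a : ExteriorAlgebra ℝ V) :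
    contractLeft (innerₗ V x) (twoVector b X * a)
      = ExteriorAlgebra.ι ℝ ((X : Module.End ℝ V) x) * a
        + twoVector b X * contractLeft (innerₗ V x) a := by
  have h1 : ∀ k, contractLeft (innerₗ V x) (ExteriorAlgebra.ι ℝ (b k)
      * ExteriorAlgebra.ι ℝ ((X : Module.End ℝ V) (b k)) * a)
      = ExteriorAlgebra.ι ℝ ((X : Module.End ℝ V) (⟪b k, x⟫_ℝ • b k)) * a
        + ExteriorAlgebra.ι ℝ (⟪b k, (X : Module.End ℝ V) x⟫_ℝ • b k) * a
        + ExteriorAlgebra.ι ℝ (b k) * ExteriorAlgebra.ι ℝ ((X : Module.End ℝ V) (b k))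
          * contractLeft (innerₗ V x) a := by
    intro k
    rw [mul_assoc, contractLeft_ι_mul', contractLeft_ι_mul', innerₗ_apply_apply,
      innerₗ_apply_apply, mul_sub, mul_smul_comm, real_inner_comm _ x,
      ← neg_neg ⟪x, (X : Module.End ℝ V) (b k)⟫_ℝ, ← inner_so_left,
      real_inner_comm (b k) ((X : Module.End ℝ V) x)]
    simp only [map_smul, smul_mul_assoc, neg_smul, mul_assoc]
    abel
  have h2 : ∑ k, ExteriorAlgebra.ι ℝ ((X : Module.End ℝ V) (⟪b k, x⟫_ℝ • b k))
      = ExteriorAlgebra.ι ℝ ((X : Module.End ℝ V) x) := by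
    rw [← map_sum, ← map_sum, b.sum_repr']
  have h3 : ∑ k, ExteriorAlgebra.ι ℝ (⟪b k, (X : Module.End ℝ V) x⟫_ℝ • b k)
      = ExteriorAlgebra.ι ℝ ((X : Module.End ℝ V) x) := by
    rw [← map_sum, b.sum_repr']
  rw [twoVector_eq, smul_mul_assoc, map_smul, Finset.sum_mul, map_sum,
    Finset.sum_congr rfl fun k _ => h1 k, Finset.sum_add_distrib, Finset.sum_add_distrib,
    ← Finset.sum_mul, ← Finset.sum_mul, ← Finset.sum_mul, h2, h3, smul_mul_assoc]
  module

/-- An order at which the powers of the elements to be exponentiated vanish: `d` elements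
`dx_k e_k` and at most `d²` elements `e_k ∧ e_l`, all of square zero, enter linearly. -/
def nilOrder (d : ℕ) : ℕ := d + d * d + 1

theorem smul_twoVector_pow (r : ℝ) (X : so V) : (r • twoVector b X) ^ (d * d + 1) = 0 := by
  have e : r • twoVector b X = ∑ p : Fin d × Fin d, if p.1 < p.2 then
      (r * ⟪(X : Module.End ℝ V) (b p.1), b p.2⟫_ℝ) •
      (ExteriorAlgebra.ι ℝ (b p.1) * ExteriorAlgebra.ι ℝ (b p.2)) else 0 := by
    rw [Fintype.sum_prod_type, twoVector, Finset.smul_sum]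
    refine Finset.sum_congr rfl fun k _ => ?_
    rw [← Finset.sum_filter, Finset.smul_sum]
    refine Finset.sum_congr (by ext; simp) fun l _ => by rw [smul_smul]
  rw [e]
  have hcard : d * d + 1 = (Finset.univ : Finset (Fin d × Fin d)).card + 1 := by simp
  rw [hcard]
  refine sum_pow_card_succ_eq_zero _ _ ?_ ?_
  · intro p _
    split_ifs
    · rw [smul_pow, ι_mul_ι_sq, smul_zero]
    · exact zero_pow two_ne_zero
  · intro p _ q _
    split_ifs
    · exact ((commute_ι_mul_ι _ _ _ _).smul_left _).smul_right _
    · exact Commute.zero_right _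
    · exact Commute.zero_left _
    · exact Commute.zero_left _

theorem twoVector_pow (r : ℝ) (X : so V) : (r • twoVector b X) ^ nilOrder d = 0 :=
  pow_eq_zero_of_le (by simp [nilOrder]) (smul_twoVector_pow b r X)

/-- The element `exp(½ ∑_{k<l} ⟨X e_k, e_l⟩ e_k ∧ e_l)` of `∧V`. -/
noncomputable def expTwoVector (X : so V) : ExteriorAlgebra ℝ V :=
  truncExp (nilOrder d) ((1 / 2 : ℝ) • twoVector b X)

theorem pfaffian_half (X : so V) : pfaffian b ((1 / 2 : ℝ) • X) = berezin b (expTwoVector b X) := by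
  rw [pfaffian, twoVector_smul, algExp_eq_truncExp (twoVector_pow b _ X), expTwoVector]

/-- If `D(a c) = u c + a D(c)` where `u` commutes with `a`, and `D(1) = 0`, then
`D(exp a) = u exp a`. -/
theorem map_truncExp {A : Type*} [Ring A] [Algebra ℝ A] (D : A →ₗ[ℝ] A) {a u : A}
    (h1 : D 1 = 0) (hD : ∀ c, D (a * c) = u * c + a * D c) (hu : Commute a u) {M : ℕ}
    (ha : a ^ M = 0) : D (truncExp M a) = u * truncExp M a := by
  have hpow : ∀ n : ℕ, D (a ^ (n + 1)) = ((n : ℝ) + 1) • (u * a ^ n) := by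
    intro n
    induction n with
    | zero => simpa [h1] using hD 1
    | succ n ih =>
      rw [pow_succ' a (n + 1), hD, ih, mul_smul_comm, ← mul_assoc, hu.eq, mul_assoc, ← pow_succ' a]
      push_cast
      module
  rw [← truncExp_eq_of_le ha M.le_succ]
  conv_rhs => rw [truncExp_eq_of_le ha M.le_succ]
  rw [truncExp, truncExp, Finset.sum_range_succ', map_add, map_sum, Finset.mul_sum]
  simp only [pow_zero, map_smul, h1, smul_zero, add_zero, mul_smul_comm, hpow, smul_smul]
  refine Finset.sum_congr rfl fun n _ => ?_
  congr 1
  rw [Nat.factorial_succ]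
  push_cast
  have : ((n : ℝ) + 1) ≠ 0 := by positivity
  field_simp

theorem contractLeft_expTwoVector (X : so V) (x : V) :
    contractLeft (innerₗ V x) (expTwoVector b X)
      = (1 / 2 : ℝ) • (ExteriorAlgebra.ι ℝ ((X : Module.End ℝ V) x) * expTwoVector b X) := by
  rw [← smul_mul_assoc]
  refine map_truncExp (contractLeft (innerₗ V x)) (CliffordAlgebra.contractLeft_one _ _) ?_ ?_
    (twoVector_pow b _ X)
  · intro c
    rw [smul_mul_assoc, map_smul, contractLeft_twoVector_mul, smul_add, smul_mul_assoc,
      smul_mul_assoc]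
  · rw [commute_iff_eq, smul_mul_smul_comm, smul_mul_smul_comm, ι_mul_twoVector]

end TwoVector

/-! ### The exponential in `∧V* ⊗ ∧V` -/

section SuperExp

open GradedTensorProduct

variable {d : ℕ} (b : OrthonormalBasis (Fin d) ℝ V)

theorem one_mem_exteriorPower_zero {M : Type*} [AddCommGroup M] [Module ℝ M] :
    (1 : ExteriorAlgebra ℝ M) ∈ ⋀[ℝ]^0 M :=
  SetLike.one_mem_graded (fun i : ℕ => ⋀[ℝ]^i M)

/-- The nilpotent part `t ∑_k dx_k e_k + ½ ∑_{k<l} ⟨X e_k, e_l⟩ e_k ∧ e_l` of `f_t(X)`. -/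
noncomputable def nilPart (t : ℝ) (X : so V) : SuperAlg V :=
  t • ∑ k : Fin d, tmul ℝ (ExteriorAlgebra.ι ℝ (b.toBasis.coord k)) (ExteriorAlgebra.ι ℝ (b k))
    + (1 / 2 : ℝ) • tmul ℝ 1 (twoVector b X)

theorem fMap_eq (t : ℝ) (X : so V) (x : V) :
    fMap b t X x = algebraMap ℝ (SuperAlg V) (-(t ^ 2 * ‖x‖ ^ 2)) + nilPart b t X := by
  rw [fMap, nilPart, add_assoc]

theorem commute_ι_tmul_ι (φ ψ : Module.Dual ℝ V) (e f : V) :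
    Commute (tmul ℝ (ExteriorAlgebra.ι ℝ φ) (ExteriorAlgebra.ι ℝ e) : SuperAlg V)
      (tmul ℝ (ExteriorAlgebra.ι ℝ ψ) (ExteriorAlgebra.ι ℝ f)) := by
  have h : ExteriorAlgebra.ι ℝ φ * ExteriorAlgebra.ι ℝ ψ
      = -(ExteriorAlgebra.ι ℝ ψ * ExteriorAlgebra.ι ℝ φ) :=
    eq_neg_of_add_eq_zero_left (ExteriorAlgebra.ι_add_mul_swap φ ψ)
  rw [commute_iff_eq, superAlg_tmul_mul_tmul _ (ι_mem_exteriorPower_one e)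
    (ι_mem_exteriorPower_one ψ), superAlg_tmul_mul_tmul _ (ι_mem_exteriorPower_one f)
    (ι_mem_exteriorPower_one φ), h, ι_mul_ι_swap e f]
  simp [tmul, TensorProduct.neg_tmul, TensorProduct.tmul_neg]

theorem commute_ι_tmul_ι_one_tmul (φ : Module.Dual ℝ V) (e : V) {ξ : ExteriorAlgebra ℝ V}
    (hξ : ξ ∈ ⋀[ℝ]^2 V) (hc : ExteriorAlgebra.ι ℝ e * ξ = ξ * ExteriorAlgebra.ι ℝ e) :
    Commute (tmul ℝ (ExteriorAlgebra.ι ℝ φ) (ExteriorAlgebra.ι ℝ e) : SuperAlg V)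
      (tmul ℝ 1 ξ) := by
  rw [commute_iff_eq, superAlg_tmul_mul_tmul _ (ι_mem_exteriorPower_one e)
    one_mem_exteriorPower_zero, superAlg_tmul_mul_tmul _ hξ (ι_mem_exteriorPower_one φ), hc]
  simp

theorem commute_ι_tmul_ι_one_tmul_ι (φ : Module.Dual ℝ V) (e v : V) :
    Commute (tmul ℝ (ExteriorAlgebra.ι ℝ φ) (ExteriorAlgebra.ι ℝ e) : SuperAlg V)
      (tmul ℝ 1 (ExteriorAlgebra.ι ℝ v)) := by
  rw [commute_iff_eq, superAlg_tmul_mul_tmul _ (ι_mem_exteriorPower_one e)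
    one_mem_exteriorPower_zero, superAlg_tmul_mul_tmul _ (ι_mem_exteriorPower_one v)
    (ι_mem_exteriorPower_one φ), ι_mul_ι_swap e v]
  simp [tmul, TensorProduct.tmul_neg]

theorem one_tmul_smul (r : ℝ) (ξ : ExteriorAlgebra ℝ V) :
    (tmul ℝ 1 (r • ξ) : SuperAlg V) = r • tmul ℝ 1 ξ := by
  simp [tmul]

theorem one_tmul_pow (ξ : ExteriorAlgebra ℝ V) (n : ℕ) :
    (tmul ℝ 1 ξ : SuperAlg V) ^ n = tmul ℝ 1 (ξ ^ n) :=
  (map_pow (includeRight (R := ℝ) (fun i : ℕ => ⋀[ℝ]^i (Module.Dual ℝ V))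
    (fun i : ℕ => ⋀[ℝ]^i V)) ξ n).symm

theorem nilPart_pow (t : ℝ) (X : so V) : nilPart b t X ^ nilOrder d = 0 := by
  have hcomm : Commute (t • ∑ k : Fin d, tmul ℝ (ExteriorAlgebra.ι ℝ (b.toBasis.coord k))
      (ExteriorAlgebra.ι ℝ (b k)) : SuperAlg V) ((1 / 2 : ℝ) • tmul ℝ 1 (twoVector b X)) :=
    ((Commute.sum_left _ _ _ fun k _ => commute_ι_tmul_ι_one_tmul _ _ (twoVector_mem b X)
      (ι_mul_twoVector b X _)).smul_left _).smul_right _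
  have h1 : (t • ∑ k : Fin d, tmul ℝ (ExteriorAlgebra.ι ℝ (b.toBasis.coord k))
      (ExteriorAlgebra.ι ℝ (b k)) : SuperAlg V) ^ (d + 1) = 0 := by
    have := sum_pow_card_succ_eq_zero (Finset.univ : Finset (Fin d))
      (fun k => (tmul ℝ (ExteriorAlgebra.ι ℝ (b.toBasis.coord k))
      (ExteriorAlgebra.ι ℝ (b k)) : SuperAlg V)) (fun k _ => ?_)
      (fun k _ l _ => commute_ι_tmul_ι _ _ _ _)
    · rw [Finset.card_univ, Fintype.card_fin] at this
      rw [smul_pow, this, smul_zero]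
    · rw [sq, superAlg_tmul_mul_tmul _ (ι_mem_exteriorPower_one _) (ι_mem_exteriorPower_one _),
        ExteriorAlgebra.ι_sq_zero]
      simp [tmul]
  have h2 : ((1 / 2 : ℝ) • tmul ℝ 1 (twoVector b X) : SuperAlg V) ^ (d * d + 1) = 0 := by
    rw [← one_tmul_smul, one_tmul_pow, smul_twoVector_pow]
    simp [tmul]
  exact hcomm.add_pow_eq_zero_of_add_le_succ_of_pow_eq_zero h1 h2 (by unfold nilOrder; omega)

/-- The exponential of the nilpotent part of `f_t(X)`. -/
noncomputable def expNilPart (t : ℝ) (X : so V) : SuperAlg V :=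
  truncExp (nilOrder d) (nilPart b t X)

theorem algExp_fMap (t : ℝ) (X : so V) (x : V) :
    algExp (fMap b t X x) = Real.exp (-(t ^ 2 * ‖x‖ ^ 2)) • expNilPart b t X := by
  rw [fMap_eq, algExp_algebraMap_add _ (nilPart_pow b t X), expNilPart]

theorem sum_coord_smul_tmul (v : V) :
    ∑ k : Fin d, b.toBasis.coord k v • (tmul ℝ 1 (ExteriorAlgebra.ι ℝ (b k)) : SuperAlg V)
      = tmul ℝ 1 (ExteriorAlgebra.ι ℝ v) := by
  have h : ∀ k, b.toBasis.coord k v • (tmul ℝ 1 (ExteriorAlgebra.ι ℝ (b k)) : SuperAlg V)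
      = tmul ℝ 1 (ExteriorAlgebra.ι ℝ (b.toBasis.coord k v • b k)) := by
    intro k
    rw [map_smul, one_tmul_smul]
  rw [Finset.sum_congr rfl fun k _ => h k]
  simp only [tmul]
  rw [← map_sum, ← TensorProduct.tmul_sum, ← map_sum]
  congr 3
  simpa using b.toBasis.sum_repr v

theorem xMap_eq (x : V) : xMap b x = tmul ℝ 1 (ExteriorAlgebra.ι ℝ x) :=
  sum_coord_smul_tmul b x

/-- The contraction of `exp(f_t)` with `v` multiplies it by the vector `t v` of `∧V`. -/
theorem contractSuper_expNilPart (t : ℝ) (X : so V) (v : V) :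
    contractSuper v (expNilPart b t X)
      = t • (tmul ℝ 1 (ExteriorAlgebra.ι ℝ v) * expNilPart b t X) := by
  rw [← smul_mul_assoc]
  refine map_truncExp (contractSuper v) (contractSuper_one_tmul v 1) ?_ ?_ (nilPart_pow b t X)
  · intro c
    rw [nilPart, add_mul, add_mul, map_add, smul_mul_assoc, smul_mul_assoc, map_smul, map_smul,
      contractSuper_one_tmul_mul v (twoVector_mem b X), Finset.sum_mul, map_sum]
    simp only [contractSuper_ι_tmul_ι_mul, Finset.sum_add_distrib]
    rw [← sum_coord_smul_tmul b v]
    simp only [Finset.sum_mul, smul_mul_assoc, Finset.smul_sum]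
    simp only [← Finset.smul_sum]
    module
  · refine Commute.smul_right (Commute.add_left (Commute.smul_left
      (Commute.sum_left _ _ _ fun k _ => commute_ι_tmul_ι_one_tmul_ι _ _ _) _)
      (Commute.smul_left ?_ _)) _
    rw [commute_iff_eq, superAlg_one_tmul_mul_one_tmul, superAlg_one_tmul_mul_one_tmul,
      ι_mul_twoVector]

theorem berezinExt_tmul (α : ExteriorAlgebra ℝ (Module.Dual ℝ V)) (ξ : ExteriorAlgebra ℝ V) :
    berezinExt b (tmul ℝ α ξ) = berezin b ξ • α := rfl

theorem berezinExt_contractSuper (v : V) (a : SuperAlg V) :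
    berezinExt b (contractSuper v a) = contractLeft (Module.Dual.eval ℝ V v) (berezinExt b a) := by
  have h : berezinExt b ∘ₗ contractSuper v
      = contractLeft (Module.Dual.eval ℝ V v) ∘ₗ berezinExt b := by
    refine superAlg_hom_ext fun i α _ ξ => ?_
    change berezinExt b (contractSuper v (tmul ℝ α ξ))
      = contractLeft (Module.Dual.eval ℝ V v) (berezinExt b (tmul ℝ α ξ))
    rw [contractSuper_tmul, berezinExt_tmul, berezinExt_tmul, map_smul]
  exact LinearMap.congr_fun h a

end SuperExp

/-! ### The Berezin integral of the exponential -/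

section ThomCoeff

open GradedTensorProduct

variable [FiniteDimensional ℝ V] {d : ℕ} (b : OrthonormalBasis (Fin d) ℝ V)

variable (V) in
/-- The degree `0` component of an element of `∧V*`. -/
noncomputable def augmentation : ExteriorAlgebra ℝ (Module.Dual ℝ V) →ₗ[ℝ] ℝ where
  toFun a := toForm V 0 a ![]
  map_add' _ _ := by simp
  map_smul' _ _ := by simp

theorem augmentation_of_mem {n : ℕ} {a : ExteriorAlgebra ℝ (Module.Dual ℝ V)}
    (ha : a ∈ ⋀[ℝ]^(n + 1) (Module.Dual ℝ V)) : augmentation V a = 0 := by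
  change toForm V 0 a ![] = 0
  rw [toForm_of_mem_exteriorPower n.succ_ne_zero ha]
  rfl

theorem augmentation_one : augmentation V 1 = 1 := toForm_zero_one _

variable (V) in
/-- The map `∧V* ⊗ ∧V → ∧V` which keeps the differential forms of degree `0`. -/
noncomputable def superAugmentation : SuperAlg V →ₗ[ℝ] ExteriorAlgebra ℝ V :=
  (TensorProduct.lid ℝ _).toLinearMap ∘ₗ LinearMap.rTensor _ (augmentation V)
    ∘ₗ (GradedTensorProduct.of ℝ _ _).symm.toLinearMap

theorem superAugmentation_tmul (α : ExteriorAlgebra ℝ (Module.Dual ℝ V))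
    (ξ : ExteriorAlgebra ℝ V) :
    superAugmentation V (tmul ℝ α ξ) = augmentation V α • ξ := rfl

/-- In form degree `0` the Berezin integral only sees the part of the argument in `∧V`. -/
theorem toForm_zero_berezinExt (a : SuperAlg V) (w : Fin 0 → V) :
    toForm V 0 (berezinExt b a) w = berezin b (superAugmentation V a) := by
  have h : augmentation V ∘ₗ berezinExt b = berezin b ∘ₗ superAugmentation V := by
    refine superAlg_hom_ext fun i α _ ξ => ?_
    change augmentation V (berezinExt b (tmul ℝ α ξ)) = berezin b (superAugmentation V (tmul ℝ α ξ))
    rw [berezinExt_tmul, superAugmentation_tmul, map_smul, map_smul, smul_eq_mul, smul_eq_mul,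
      mul_comm]
  rw [Subsingleton.elim w ![]]
  exact LinearMap.congr_fun h a

theorem superAugmentation_one_tmul_mul {j : ℕ} {η : ExteriorAlgebra ℝ V} (hη : η ∈ ⋀[ℝ]^j V)
    (a : SuperAlg V) : superAugmentation V (tmul ℝ 1 η * a) = η * superAugmentation V a := by
  have h : superAugmentation V ∘ₗ LinearMap.mulLeft ℝ (tmul ℝ 1 η : SuperAlg V)
      = LinearMap.mulLeft ℝ η ∘ₗ superAugmentation V := by
    refine superAlg_hom_ext fun i α hα ξ => ?_
    change superAugmentation V (tmul ℝ 1 η * tmul ℝ α ξ) = η * superAugmentation V (tmul ℝ α ξ)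
    rw [superAlg_tmul_mul_tmul 1 hη hα, map_smul, superAugmentation_tmul, superAugmentation_tmul,
      one_mul, mul_smul_comm]
    cases i with
    | zero => simp
    | succ i => rw [augmentation_of_mem hα, zero_smul, smul_zero]
  exact LinearMap.congr_fun h a

theorem superAugmentation_ι_tmul_ι_mul (φ : Module.Dual ℝ V) (e : V) (a : SuperAlg V) :
    superAugmentation V (tmul ℝ (ExteriorAlgebra.ι ℝ φ) (ExteriorAlgebra.ι ℝ e) * a) = 0 := by
  have h : superAugmentation V ∘ₗ LinearMap.mulLeft ℝ
      (tmul ℝ (ExteriorAlgebra.ι ℝ φ) (ExteriorAlgebra.ι ℝ e) : SuperAlg V) = 0 := by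
    refine superAlg_hom_ext fun i α hα ξ => ?_
    change superAugmentation V (tmul ℝ (ExteriorAlgebra.ι ℝ φ) (ExteriorAlgebra.ι ℝ e)
      * tmul ℝ α ξ) = 0
    have hm : ExteriorAlgebra.ι ℝ φ * α ∈ ⋀[ℝ]^(i + 1) (Module.Dual ℝ V) := by
      rw [add_comm]
      exact SetLike.mul_mem_graded (ι_mem_exteriorPower_one φ) hα
    rw [superAlg_tmul_mul_tmul _ (ι_mem_exteriorPower_one e) hα, map_smul, superAugmentation_tmul,
      augmentation_of_mem hm, zero_smul, smul_zero]
  exact LinearMap.congr_fun h a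

theorem superAugmentation_expNilPart (t : ℝ) (X : so V) :
    superAugmentation V (expNilPart b t X) = expTwoVector b X := by
  have h1 : ∀ a, superAugmentation V (nilPart b t X * a)
      = (1 / 2 : ℝ) • twoVector b X * superAugmentation V a := by
    intro a
    rw [nilPart, add_mul, map_add, smul_mul_assoc, smul_mul_assoc, map_smul, map_smul,
      superAugmentation_one_tmul_mul (twoVector_mem b X), Finset.sum_mul, map_sum,
      Finset.sum_eq_zero fun k _ => superAugmentation_ι_tmul_ι_mul _ _ _, smul_zero, zero_add,
      smul_mul_assoc]
  have h2 : ∀ n, superAugmentation V (nilPart b t X ^ n) = ((1 / 2 : ℝ) • twoVector b X) ^ n := by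
    intro n
    induction n with
    | zero =>
      rw [pow_zero, pow_zero]
      change superAugmentation V (tmul ℝ 1 1) = 1
      rw [superAugmentation_tmul, augmentation_one, one_smul]
    | succ n ih => rw [pow_succ', h1, ih, pow_succ']
  rw [expNilPart, expTwoVector, truncExp, truncExp, map_sum]
  exact Finset.sum_congr rfl fun n _ => by rw [map_smul, h2]

/-- The sign `(-1)^{k(k-1)/2}` of the reversal of `k` letters. -/
def revSign (k : ℕ) : ℝ := (-1) ^ (k * (k - 1) / 2)

theorem revSign_succ (k : ℕ) : revSign (k + 1) = (-1) ^ k * revSign k := by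
  rw [revSign, revSign, ← pow_add, Nat.triangle_succ, add_comm]

theorem revSign_zero : revSign 0 = 1 := by simp [revSign]

/-- Evaluating on `v₁, …, v_k` means contracting `k` times, and each contraction of the exponential
produces a factor `t v_i` in `∧V`. The signs come from moving the vectors past `η` and past each
other. -/
theorem toForm_berezinExt_mul_expNilPart (t : ℝ) (X : so V) (k : ℕ) (v : Fin k → V) {p : ℕ}
    {η : ExteriorAlgebra ℝ V} (hη : η ∈ ⋀[ℝ]^p V) :
    toForm V k (berezinExt b (tmul ℝ 1 η * expNilPart b t X)) v
      = (-1) ^ (p * k) * revSign k * t ^ k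
        * berezin b (η * (ExteriorAlgebra.ιMulti ℝ k v * expTwoVector b X)) := by
  induction k generalizing p η with
  | zero =>
    rw [toForm_zero_berezinExt, superAugmentation_one_tmul_mul hη, superAugmentation_expNilPart,
      ExteriorAlgebra.ιMulti_zero_apply, one_mul, revSign_zero]
    simp
  | succ k ih =>
    have hη' : η * ExteriorAlgebra.ι ℝ (v 0) ∈ ⋀[ℝ]^(p + 1) V :=
      SetLike.mul_mem_graded hη (ι_mem_exteriorPower_one _)
    have e : v = Matrix.vecCons (v 0) (fun i => v i.succ) := (Matrix.cons_head_tail v).symm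
    conv_lhs => rw [e]
    rw [toForm_succ_apply, ← berezinExt_contractSuper, contractSuper_one_tmul_mul _ hη,
      contractSuper_expNilPart, mul_smul_comm, ← mul_assoc, superAlg_one_tmul_mul_one_tmul,
      map_smul, map_smul, map_smul, map_smul, ContinuousAlternatingMap.smul_apply,
      ContinuousAlternatingMap.smul_apply, ih _ hη', ιMulti_succ_mul, revSign_succ, smul_eq_mul,
      smul_eq_mul, mul_assoc η]
    ring

/-- The constant form `C_k(X)`: the component of degree `k` of `T(exp(∑ dx_k e_k + ½ ∑_{k<l}
⟨X e_k, e_l⟩ e_k ∧ e_l))`. -/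
noncomputable def thomCoeff (X : so V) (k : ℕ) : V [⋀^Fin k]→L[ℝ] ℝ :=
  toForm V k (berezinExt b (expNilPart b 1 X))

theorem thomCoeff_apply (X : so V) (k : ℕ) (v : Fin k → V) :
    thomCoeff b X k v
      = revSign k * berezin b (ExteriorAlgebra.ιMulti ℝ k v * expTwoVector b X) := by
  have h := toForm_berezinExt_mul_expNilPart b 1 X k v one_mem_exteriorPower_zero
  have e : (tmul ℝ 1 1 : SuperAlg V) = 1 := rfl
  rw [e, one_mul, one_mul] at h
  simpa [thomCoeff] using h

theorem toForm_berezinExt_expNilPart (t : ℝ) (X : so V) (k : ℕ) :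
    toForm V k (berezinExt b (expNilPart b t X)) = t ^ k • thomCoeff b X k := by
  ext v
  have h := toForm_berezinExt_mul_expNilPart b t X k v one_mem_exteriorPower_zero
  have e : (tmul ℝ 1 1 : SuperAlg V) = 1 := rfl
  rw [e, one_mul, one_mul] at h
  rw [h, ContinuousAlternatingMap.smul_apply, thomCoeff_apply, smul_eq_mul]
  ring

theorem toForm_berezinExt_ι_mul_expNilPart (t : ℝ) (X : so V) (k : ℕ) (x : V) :
    toForm V k (berezinExt b (tmul ℝ 1 (ExteriorAlgebra.ι ℝ x) * expNilPart b t X))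
      = t ^ k • (thomCoeff b X (k + 1)).curryLeft x := by
  ext v
  rw [toForm_berezinExt_mul_expNilPart b t X k v (ι_mem_exteriorPower_one x),
    ContinuousAlternatingMap.smul_apply, ContinuousAlternatingMap.curryLeft_apply_apply,
    thomCoeff_apply, ιMulti_succ_mul, smul_eq_mul, revSign_succ]
  simp only [Matrix.cons_val_zero, Matrix.cons_val_succ]
  ring

theorem cForm_eq (t : ℝ) (X : so V) (k : ℕ) (x : V) :
    cForm b t X k x = (Real.exp (-(t ^ 2 * ‖x‖ ^ 2)) * t ^ k) • thomCoeff b X k := by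
  rw [cForm, algExp_fMap, map_smul, map_smul, toForm_berezinExt_expNilPart, smul_smul]

theorem etaForm_eq (t : ℝ) (X : so V) (k : ℕ) (x : V) :
    etaForm b t X k x
      = -((Real.exp (-(t ^ 2 * ‖x‖ ^ 2)) * t ^ k) • (thomCoeff b X (k + 1)).curryLeft x) := by
  rw [etaForm, algExp_fMap, xMap_eq, mul_smul_comm, map_neg, map_smul, map_smul,
    toForm_berezinExt_ι_mul_expNilPart, smul_smul]

theorem thomCoeff_zero (X : so V) :
    thomCoeff b X 0 = ContinuousAlternatingMap.constOfIsEmpty ℝ V (Fin 0)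
      (pfaffian b ((1 / 2 : ℝ) • X)) := by
  ext v
  rw [thomCoeff_apply, revSign_zero, pfaffian_half, ExteriorAlgebra.ιMulti_zero_apply]
  simp

/-- The component of top degree does not depend on `X`. -/
theorem thomCoeff_top (X : so V) (v : Fin d → V) :
    thomCoeff b X d v = revSign d * b.toBasis.det v := by
  have hv : ExteriorAlgebra.ιMulti ℝ d v ∈ ⋀[ℝ]^d V := ExteriorAlgebra.ιMulti_range ℝ d ⟨v, rfl⟩
  rw [thomCoeff_apply, expTwoVector, truncExp, Finset.mul_sum, map_sum,
    Finset.sum_eq_single_of_mem 0 (by simp [nilOrder])]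
  · simp [berezin_ιMulti]
  · intro n _ hn
    have h2 := SetLike.mul_mem_graded hv (SetLike.pow_mem_graded n
      (Submodule.smul_mem _ (1 / 2 : ℝ) (twoVector_mem b X)))
    rw [mul_smul_comm, map_smul, berezin_of_mem_exteriorPower b _ h2, smul_zero]
    simp only [smul_eq_mul]
    omega

/-- The identity `½ ι(Xx) C_{k+2} = λ ∧ C_k`, where `λ = ⟨x, ·⟩`: the Berezin integral of the
contraction of `v₁ ∧ ⋯ ∧ v_k ∧ exp(½ X)` with `x` vanishes. -/
theorem wedgeOne_thomCoeff (X : so V) (x : V) (k : ℕ) :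
    wedgeOne (innerSL ℝ x) (thomCoeff b X k)
      = (1 / 2 : ℝ) • (thomCoeff b X (k + 2)).curryLeft ((X : Module.End ℝ V) x) := by
  ext v
  have h := berezin_contractLeft b (innerₗ V x)
    (ExteriorAlgebra.ιMulti ℝ (k + 1) v * expTwoVector b X)
  rw [contractLeft_ιMulti_mul, contractLeft_expTwoVector, mul_smul_comm, ← mul_assoc,
    ιMulti_mul_ι, smul_mul_assoc, mul_assoc, map_add, map_sum] at h
  simp only [map_smul, smul_eq_mul, innerₗ_apply_apply] at h
  rw [wedgeOne, ContinuousAlternatingMap.alternatizeUncurryFin_apply,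
    ContinuousAlternatingMap.smul_apply, ContinuousAlternatingMap.curryLeft_apply_apply,
    thomCoeff_apply, ιMulti_succ_mul, Matrix.cons_val_zero]
  simp only [Matrix.cons_val_succ, ContinuousLinearMap.smulRight_apply,
    ContinuousAlternatingMap.smul_apply, thomCoeff_apply, innerSL_apply_apply, smul_eq_mul,
    zsmul_eq_mul, revSign_succ, Int.cast_pow, Int.cast_neg, Int.cast_one]
  have h' : ∑ i : Fin (k + 1), (-1 : ℝ) ^ (i : ℕ) * (⟪x, v i⟫_ℝ * (revSign k
      * berezin b (ExteriorAlgebra.ιMulti ℝ k (i.removeNth v) * expTwoVector b X)))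
      = revSign k * ∑ i : Fin (k + 1), (-1 : ℝ) ^ (i : ℕ) * ⟪x, v i⟫_ℝ
        * berezin b (ExteriorAlgebra.ιMulti ℝ k (i.removeNth v) * expTwoVector b X) := by
    rw [Finset.mul_sum]
    exact Finset.sum_congr rfl fun i _ => by ring
  rw [h', eq_neg_of_add_eq_zero_left h]
  ring

theorem thomCoeff_one_curryLeft (X : so V) (x : V) :
    (thomCoeff b X 1).curryLeft ((X : Module.End ℝ V) x) = 0 := by
  ext v
  have h := berezin_contractLeft b (innerₗ V x) (expTwoVector b X)
  rw [contractLeft_expTwoVector, map_smul, smul_eq_mul] at h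
  rw [ContinuousAlternatingMap.curryLeft_apply_apply, thomCoeff_apply, ιMulti_succ_mul,
    ExteriorAlgebra.ιMulti_zero_apply, one_mul, Matrix.cons_val_zero]
  simp only [one_div, mul_eq_zero, inv_eq_zero, OfNat.ofNat_ne_zero, false_or] at h
  rw [h, mul_zero]
  rfl

end ThomCoeff

/-! ### Polynomial maps on `𝔰𝔬(V)` -/

section Poly

variable (V) in
/-- The polynomial maps from `𝔰𝔬(V)` to a vector space. -/
def polyMaps (W : Type*) [AddCommGroup W] [Module ℝ W] : Submodule ℝ (so V → W) :=
  Submodule.span ℝ {f | ∃ P ∈ polyFun V, ∃ w : W, f = fun X => P X • w}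

theorem smul_mem_polyMaps {W : Type*} [AddCommGroup W] [Module ℝ W] {P : so V → ℝ}
    (hP : P ∈ polyFun V) (w : W) : (fun X => P X • w) ∈ polyMaps V W :=
  Submodule.subset_span ⟨P, hP, w, rfl⟩

theorem const_mem_polyMaps {W : Type*} [AddCommGroup W] [Module ℝ W] (w : W) :
    (fun _ => w) ∈ polyMaps V W := by
  simpa using smul_mem_polyMaps (one_mem (polyFun V)) w

theorem linear_mem_polyMaps [FiniteDimensional ℝ V] {W : Type*} [AddCommGroup W] [Module ℝ W]
    (L : so V →ₗ[ℝ] W) : (fun X => L X) ∈ polyMaps V W := by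
  let B := Module.finBasis ℝ (so V)
  have h : (fun X => L X) = ∑ i, fun X => B.coord i X • L (B i) := by
    funext X
    conv_lhs => rw [← B.sum_repr X, map_sum]
    simp [Finset.sum_apply]
  rw [h]
  exact Submodule.sum_mem _ fun i _ =>
    smul_mem_polyMaps (Algebra.subset_adjoin ⟨B.coord i, rfl⟩) _

theorem mul_mem_polyMaps {W : Type*} [Ring W] [Algebra ℝ W] {f g : so V → W}
    (hf : f ∈ polyMaps V W) (hg : g ∈ polyMaps V W) : (fun X => f X * g X) ∈ polyMaps V W := by
  induction hf using Submodule.span_induction with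
  | mem f hf =>
    obtain ⟨P, hP, w, rfl⟩ := hf
    induction hg using Submodule.span_induction with
    | mem g hg =>
      obtain ⟨Q, hQ, u, rfl⟩ := hg
      have : (fun X => P X • w * Q X • u) = fun X => (P * Q) X • (w * u) := by
        funext X
        rw [smul_mul_smul_comm, Pi.mul_apply]
      rw [this]
      exact smul_mem_polyMaps (mul_mem hP hQ) _
    | zero =>
      convert! Submodule.zero_mem (polyMaps V W) using 1
      funext X
      simp
    | add a c _ _ ha hc =>
      convert! Submodule.add_mem _ ha hc using 1
      funext X
      simp [mul_add]
    | smul r a _ ha =>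
      convert! Submodule.smul_mem _ r ha using 1
      funext X
      simp
  | zero =>
    convert! Submodule.zero_mem (polyMaps V W) using 1
    funext X
    simp
  | add a c _ _ ha hc =>
    convert! Submodule.add_mem _ ha hc using 1
    funext X
    simp [add_mul]
  | smul r a _ ha =>
    convert! Submodule.smul_mem _ r ha using 1
    funext X
    simp

theorem truncExp_mem_polyMaps {W : Type*} [Ring W] [Algebra ℝ W] (M : ℕ) {f : so V → W}
    (hf : f ∈ polyMaps V W) : (fun X => truncExp M (f X)) ∈ polyMaps V W := by
  have hpow : ∀ n : ℕ, (fun X => f X ^ n) ∈ polyMaps V W := by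
    intro n
    induction n with
    | zero => simpa using const_mem_polyMaps (V := V) (1 : W)
    | succ n ih => simpa [pow_succ] using mul_mem_polyMaps ih hf
  have h : (fun X => truncExp M (f X))
      = ∑ n ∈ Finset.range M, ((n.factorial : ℝ)⁻¹) • fun X => f X ^ n := by
    funext X
    simp [truncExp, Finset.sum_apply]
  rw [h]
  exact Submodule.sum_mem _ fun n _ => Submodule.smul_mem _ _ (hpow n)

theorem comp_mem_polyForms {W : Type*} [AddCommGroup W] [Module ℝ W] {f : so V → W}
    (hf : f ∈ polyMaps V W) {S : Submodule ℝ (MForm V)} (L : W →ₗ[ℝ] MForm V)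
    (hL : ∀ w, L w ∈ S) : (fun X => L (f X)) ∈ polyForms S := by
  induction hf using Submodule.span_induction with
  | mem f hf =>
    obtain ⟨P, hP, w, rfl⟩ := hf
    refine Submodule.subset_span ⟨P, hP, L w, hL w, ?_⟩
    funext X
    rw [map_smul]
  | zero =>
    convert! Submodule.zero_mem (polyForms S) using 1
    funext X
    simp
  | add a c _ _ ha hc =>
    convert! Submodule.add_mem _ ha hc using 1
    funext X
    simp
  | smul r a _ ha =>
    convert! Submodule.smul_mem _ r ha using 1
    funext X
    simp

end Poly

section ThomCoeffPoly

open GradedTensorProduct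

variable {d : ℕ} (b : OrthonormalBasis (Fin d) ℝ V)

/-- `X ↦ ∑_{k<l} ⟨X e_k, e_l⟩ e_k ∧ e_l` as a linear map. -/
noncomputable def twoVectorLinear : so V →ₗ[ℝ] ExteriorAlgebra ℝ V where
  toFun X := twoVector b X
  map_add' X Y := by
    simp only [twoVector, Submodule.coe_add, LinearMap.add_apply, inner_add_left, add_smul,
      Finset.sum_add_distrib]
  map_smul' r X := twoVector_smul b r X

theorem expNilPart_mem_polyMaps [FiniteDimensional ℝ V] (t : ℝ) :
    (fun X => expNilPart b t X) ∈ polyMaps V (SuperAlg V) := by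
  refine truncExp_mem_polyMaps _ (Submodule.add_mem _ (const_mem_polyMaps _) ?_)
  exact linear_mem_polyMaps ((1 / 2 : ℝ) •
    ((includeRight (R := ℝ) (fun i : ℕ => ⋀[ℝ]^i (Module.Dual ℝ V))
      (fun i : ℕ => ⋀[ℝ]^i V)).toLinearMap ∘ₗ twoVectorLinear b))

/-- A form whose coefficients are linear in the constant forms `C_k(X)` is polynomial in `X`. -/
theorem mem_polyForms_of_thomCoeff [FiniteDimensional ℝ V] {S : Submodule ℝ (MForm V)}
    (G : ∀ k, V → (∀ j : ℕ, V [⋀^Fin j]→L[ℝ] ℝ) →ₗ[ℝ] V [⋀^Fin k]→L[ℝ] ℝ)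
    (hG : ∀ c, (fun k x => G k x c) ∈ S) :
    (fun X k x => G k x (thomCoeff b X)) ∈ polyForms S := by
  let L : SuperAlg V →ₗ[ℝ] MForm V :=
    LinearMap.pi fun k => LinearMap.pi fun x =>
      G k x ∘ₗ LinearMap.pi fun j => toForm V j ∘ₗ berezinExt b
  exact comp_mem_polyForms (expNilPart_mem_polyMaps b 1) L fun a =>
    hG fun j => toForm V j (berezinExt b a)

/-! ### Equivariance -/

theorem twoVector_Ad (g : V ≃ₗᵢ[ℝ] V) (X : so V) : twoVector b (Ad g X)
    = ExteriorAlgebra.map (g.toLinearEquiv : V →ₗ[ℝ] V) (twoVector b X) := by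
  -- both sides are sums `½ ∑ₖ fₖ ∧ Y fₖ`, over two orthonormal bases
  have h : ∀ k, ExteriorAlgebra.ι ℝ (b k)
      * ExteriorAlgebra.ι ℝ ((Ad g X : Module.End ℝ V) (b k))
      = ∑ j, ExteriorAlgebra.ι ℝ (g (b j)) * ExteriorAlgebra.ι ℝ
          (g ((X : Module.End ℝ V) (⟪b k, g (b j)⟫_ℝ • g.symm (b k)))) := by
    intro k
    have e : b k = ∑ j, ⟪b k, g (b j)⟫_ℝ • g (b j) := by
      have := (b.map g).sum_repr' (b k)
      simp only [OrthonormalBasis.map_apply] at this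
      rw [← this]
      refine (Finset.sum_congr rfl fun j _ => ?_).symm
      rw [real_inner_comm, this]
    conv_lhs => rw [e, map_sum, Finset.sum_mul, ← e]
    refine Finset.sum_congr rfl fun j _ => ?_
    simp only [map_smul, smul_mul_assoc, mul_smul_comm]
    rfl
  rw [twoVector_eq, twoVector_eq, map_smul, map_sum, Finset.sum_congr rfl fun k _ => h k,
    Finset.sum_comm]
  congr 1
  refine Finset.sum_congr rfl fun j _ => ?_
  rw [← Finset.mul_sum, map_mul, ExteriorAlgebra.map_apply_ι, ExteriorAlgebra.map_apply_ι,
    ← map_sum]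
  congr 2
  have e : ∑ k, ⟪b k, g (b j)⟫_ℝ • g.symm (b k) = b j := by
    have := congrArg g.symm (b.sum_repr' (g (b j)))
    rw [map_sum] at this
    simpa using this
  change _ = g ((X : Module.End ℝ V) (b j))
  rw [← map_sum, ← map_sum, e]

theorem berezin_map {g : V ≃ₗᵢ[ℝ] V} (hg : g ∈ SO V) (a : ExteriorAlgebra ℝ V) :
    berezin b (ExteriorAlgebra.map (g.toLinearEquiv : V →ₗ[ℝ] V) a) = berezin b a := by
  have h : berezin b ∘ₗ (ExteriorAlgebra.map (g.toLinearEquiv : V →ₗ[ℝ] V)).toLinearMap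
      = berezin b := by
    refine ExteriorAlgebra.lhom_ext fun n => ?_
    ext v
    change berezin b (ExteriorAlgebra.map _ (ExteriorAlgebra.ιMulti ℝ n v))
      = berezin b (ExteriorAlgebra.ιMulti ℝ n v)
    rw [ExteriorAlgebra.map_apply_ιMulti]
    by_cases hn : n = d
    · subst hn
      rw [berezin_ιMulti, berezin_ιMulti, Module.Basis.det_comp, show LinearMap.det _ = _ from hg,
        one_mul]
    · rw [berezin_of_mem_exteriorPower b hn (ExteriorAlgebra.ιMulti_range ℝ n ⟨_, rfl⟩),
        berezin_of_mem_exteriorPower b hn (ExteriorAlgebra.ιMulti_range ℝ n ⟨_, rfl⟩)]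
  exact LinearMap.congr_fun h a

/-- Equivariance of the constant forms `C_k(X)`: the bivector of `g X g⁻¹` is the image of that of
`X`, and rotations preserve the Berezin integral. -/
theorem thomCoeff_Ad [FiniteDimensional ℝ V] {g : V ≃ₗᵢ[ℝ] V} (hg : g ∈ SO V) (X : so V) (k : ℕ) :
    (thomCoeff b (Ad g X) k).compContinuousLinearMap (g.toContinuousLinearEquiv : V →L[ℝ] V)
      = thomCoeff b X k := by
  ext v
  have h1 : expTwoVector b (Ad g X)
      = ExteriorAlgebra.map (g.toLinearEquiv : V →ₗ[ℝ] V) (expTwoVector b X) := by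
    simp only [expTwoVector, truncExp, map_sum, map_smul, map_pow, twoVector_Ad]
  rw [ContinuousAlternatingMap.compContinuousLinearMap_apply, thomCoeff_apply, thomCoeff_apply, h1,
    ← berezin_map b hg (ExteriorAlgebra.ιMulti ℝ k v * _), map_mul (ExteriorAlgebra.map _),
    ExteriorAlgebra.map_apply_ιMulti]
  rfl

end ThomCoeffPoly

/-! ### Functions invariant under `SO(V)` -/

section Invariant

/-- The flow `exp(sX)` of an antisymmetric endomorphism consists of rotations. -/
theorem exists_SO_eq_exp [FiniteDimensional ℝ V] (X : so V) (s : ℝ) :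
    ∃ g ∈ SO V, ∀ x, g x = NormedSpace.exp
      (s • LinearMap.toContinuousLinearMap (X : Module.End ℝ V)) x := by
  have : CompleteSpace V := FiniteDimensional.complete ℝ V
  let _ : NormedAlgebra ℚ (V →L[ℝ] V) := NormedAlgebra.restrictScalars ℚ ℝ _
  set T := LinearMap.toContinuousLinearMap (X : Module.End ℝ V) with hT
  have hskew : ∀ r : ℝ, r • T ∈ skewAdjoint (V →L[ℝ] V) := by
    intro r
    rw [skewAdjoint.mem_iff, ContinuousLinearMap.star_eq_adjoint]
    refine ((ContinuousLinearMap.eq_adjoint_iff _ _).2 fun x y => ?_).symm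
    have := inner_so_left X x y
    simp only [neg_apply, smul_apply, hT,
      LinearMap.coe_toContinuousLinearMap', inner_neg_left, inner_smul_left, inner_smul_right, this]
    simp
  have hU : ∀ r : ℝ, NormedSpace.exp (r • T) ∈ unitary (V →L[ℝ] V) := fun r =>
    NormedSpace.exp_mem_unitary_of_mem_skewAdjoint (hskew r)
  let g : ℝ → (V ≃ₗᵢ[ℝ] V) := fun r => Unitary.linearIsometryEquiv ⟨_, hU r⟩
  have hg : ∀ r x, g r x = NormedSpace.exp (r • T) x := fun r x => rfl
  refine ⟨g s, ?_, hg s⟩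
  -- `exp(sX)` is the square of `exp(sX/2)`, whose determinant is `±1`
  have hcomp : ((g s).toLinearEquiv : V →ₗ[ℝ] V)
      = ((g (s / 2)).toLinearEquiv : V →ₗ[ℝ] V) ∘ₗ ((g (s / 2)).toLinearEquiv : V →ₗ[ℝ] V) := by
    ext x
    change g s x = g (s / 2) (g (s / 2) x)
    rw [hg, hg, hg, ← mul_apply_eq_comp, ← NormedSpace.exp_add_of_commute
      (Commute.refl _), ← add_smul, add_halves]
  change LinearMap.det ((g s).toLinearEquiv : V →ₗ[ℝ] V) = 1
  rw [hcomp, LinearMap.det_comp]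
  have h1 := (g (s / 2)).toLinearIsometry.normDet_eq_one
  rw [LinearMap.normDet_eq_abs_det] at h1
  exact (abs_mul_abs_self _).symm.trans ((congrArg₂ (· * ·) h1 h1).trans (one_mul 1))

/-- The differential of an invariant function vanishes on the vector fields of the rotations. -/
theorem fderiv_apply_so_of_invariant [FiniteDimensional ℝ V] {χ : V → ℝ}
    (hχ : ∀ g ∈ SO V, ∀ x, χ (g x) = χ x) {x : V} (hd : DifferentiableAt ℝ χ x) (X : so V) :
    fderiv ℝ χ x ((X : Module.End ℝ V) x) = 0 := by
  have h1 := hasDerivAt_exp_vectorField X x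
  have h2 : HasDerivAt (fun ε : ℝ => χ (NormedSpace.exp
      (-ε • LinearMap.toContinuousLinearMap (X : Module.End ℝ V)) x))
      (fderiv ℝ χ x (vectorField X x)) 0 := by
    have h3 : HasFDerivAt χ (fderiv ℝ χ x) (NormedSpace.exp
      (-(0 : ℝ) • LinearMap.toContinuousLinearMap (X : Module.End ℝ V)) x) := by
      simpa using hd.hasFDerivAt
    exact h3.comp_hasDerivAt (0 : ℝ) h1
  have h4 : (fun ε : ℝ => χ (NormedSpace.exp
      (-ε • LinearMap.toContinuousLinearMap (X : Module.End ℝ V)) x)) = fun _ => χ x := by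
    funext ε
    obtain ⟨g, hg, hgx⟩ := exists_SO_eq_exp X (-ε)
    rw [← hgx, hχ g hg]
  rw [h4] at h2
  have := h2.unique (hasDerivAt_const (0 : ℝ) (χ x))
  simpa [vectorField] using this

theorem fderiv_comp_of_invariant {χ : V → ℝ} (hχ : ∀ g ∈ SO V, ∀ x, χ (g x) = χ x)
    {g : V ≃ₗᵢ[ℝ] V} (hg : g ∈ SO V) (x : V) :
    (fderiv ℝ χ (g x)).comp (g.toContinuousLinearEquiv : V →L[ℝ] V) = fderiv ℝ χ x := by
  have h : χ ∘ g.toContinuousLinearEquiv = χ := funext fun y => hχ g hg y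
  conv_rhs => rw [← h, ContinuousLinearEquiv.comp_right_fderiv]
  rfl

end Invariant

/-! ### Exterior calculus with one-forms -/

section Calculus

variable {k : ℕ}

theorem wedgeOne_apply (φ : V →L[ℝ] ℝ) (θ : V [⋀^Fin k]→L[ℝ] ℝ) (v : Fin (k + 1) → V) :
    wedgeOne φ θ v = ∑ i : Fin (k + 1), (-1 : ℝ) ^ (i : ℕ) * (φ (v i) * θ (i.removeNth v)) := by
  rw [wedgeOne, ContinuousAlternatingMap.alternatizeUncurryFin_apply]
  refine Finset.sum_congr rfl fun i _ => ?_
  simp [zsmul_eq_mul]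

theorem wedgeOne_smul_left (r : ℝ) (φ : V →L[ℝ] ℝ) (θ : V [⋀^Fin k]→L[ℝ] ℝ) :
    wedgeOne (r • φ) θ = r • wedgeOne φ θ := by
  ext v
  simp only [wedgeOne_apply, ContinuousAlternatingMap.smul_apply, smul_apply, smul_eq_mul,
    Finset.mul_sum]
  exact Finset.sum_congr rfl fun i _ => by ring

theorem wedgeOne_smul_right (r : ℝ) (φ : V →L[ℝ] ℝ) (θ : V [⋀^Fin k]→L[ℝ] ℝ) :
    wedgeOne φ (r • θ) = r • wedgeOne φ θ := by
  ext v
  simp only [wedgeOne_apply, ContinuousAlternatingMap.smul_apply, smul_eq_mul,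
    Finset.mul_sum]
  exact Finset.sum_congr rfl fun i _ => by ring

theorem wedgeOne_add_right (φ : V →L[ℝ] ℝ) (θ θ' : V [⋀^Fin k]→L[ℝ] ℝ) :
    wedgeOne φ (θ + θ') = wedgeOne φ θ + wedgeOne φ θ' := by
  ext v
  simp only [wedgeOne_apply, ContinuousAlternatingMap.add_apply, mul_add, Finset.sum_add_distrib]

theorem wedgeOne_neg_right (φ : V →L[ℝ] ℝ) (θ : V [⋀^Fin k]→L[ℝ] ℝ) :
    wedgeOne φ (-θ) = -wedgeOne φ θ := by
  ext v
  simp only [wedgeOne_apply, ContinuousAlternatingMap.neg_apply, mul_neg, Finset.sum_neg_distrib]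

theorem wedgeOne_zero_left (θ : V [⋀^Fin k]→L[ℝ] ℝ) : wedgeOne 0 θ = 0 := by
  simpa using wedgeOne_smul_left 0 0 θ

theorem curryLeft_wedgeOne_zero (φ : V →L[ℝ] ℝ) (θ : V [⋀^Fin 0]→L[ℝ] ℝ) (x : V) :
    (wedgeOne φ θ).curryLeft x = φ x • θ := by
  ext v
  rw [ContinuousAlternatingMap.curryLeft_apply_apply, wedgeOne_apply]
  simp [Subsingleton.elim _ v]

/-- Contraction with `x` is an antiderivation. -/
theorem curryLeft_wedgeOne_succ (φ : V →L[ℝ] ℝ) (θ : V [⋀^Fin (k + 1)]→L[ℝ] ℝ) (x : V) :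
    (wedgeOne φ θ).curryLeft x = φ x • θ - wedgeOne φ (θ.curryLeft x) := by
  ext v
  rw [ContinuousAlternatingMap.curryLeft_apply_apply, wedgeOne_apply, Fin.sum_univ_succ,
    ContinuousAlternatingMap.sub_apply, wedgeOne_apply, sub_eq_add_neg, ← Finset.sum_neg_distrib]
  congr 1
  · simp
  · refine Finset.sum_congr rfl fun i _ => ?_
    have e : i.succ.removeNth (Matrix.vecCons x v) = Matrix.vecCons x (i.removeNth v) := by
      ext j
      refine Fin.cases ?_ (fun j => ?_) j <;> simp [Fin.removeNth_apply]
    rw [e, ContinuousAlternatingMap.curryLeft_apply_apply]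
    simp [pow_succ]

theorem extDeriv_smul_const {g : V → ℝ} {g' : V →L[ℝ] ℝ} {x : V} (hg : HasFDerivAt g g' x)
    (C : V [⋀^Fin k]→L[ℝ] ℝ) : extDeriv (fun y => g y • C) x = wedgeOne g' C := by
  rw [extDeriv, (hg.smul_const C).fderiv]
  rfl

theorem hasFDerivAt_smul_curryLeft {g : V → ℝ} {g' : V →L[ℝ] ℝ} {x : V} (hg : HasFDerivAt g g' x)
    (C : V [⋀^Fin (k + 1)]→L[ℝ] ℝ) : HasFDerivAt (fun y => g y • C.curryLeft y)
      (g x • C.curryLeft + g'.smulRight (C.curryLeft x)) x :=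
  hg.smul C.curryLeft.hasFDerivAt

/-- The product rule, with `d(ι(y) C) = (k + 1) C` for a constant form `C` of degree `k + 1`. -/
theorem extDeriv_smul_curryLeft {g : V → ℝ} {g' : V →L[ℝ] ℝ} {x : V} (hg : HasFDerivAt g g' x)
    (C : V [⋀^Fin (k + 1)]→L[ℝ] ℝ) : extDeriv (fun y => g y • C.curryLeft y) x
      = (((k : ℝ) + 1) * g x) • C + wedgeOne g' (C.curryLeft x) := by
  rw [extDeriv, (hasFDerivAt_smul_curryLeft hg C).fderiv,
    ContinuousAlternatingMap.alternatizeUncurryFin_add,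
    ContinuousAlternatingMap.alternatizeUncurryFin_smul,
    ContinuousAlternatingMap.alternatizeUncurryFin_curryLeft, wedgeOne]
  congr 1
  rw [← Nat.cast_smul_eq_nsmul ℝ, smul_smul, mul_comm]
  push_cast
  rfl

/-- The product rule for `y ↦ φ(y) ⊗ θ(y)`, with the derivative described by its values. -/
theorem exists_hasFDerivAt_smulRight {F : Type*} [NormedAddCommGroup F] [NormedSpace ℝ F]
    {φ : V → V →L[ℝ] ℝ} {φ' : V →L[ℝ] V →L[ℝ] ℝ} {θ : V → F} {θ' : V →L[ℝ] F} {x : V}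
    (hφ : HasFDerivAt φ φ' x) (hθ : HasFDerivAt θ θ' x) :
    ∃ D : V →L[ℝ] V →L[ℝ] F, HasFDerivAt (fun y => (φ y).smulRight (θ y)) D x ∧
      ∀ v w, D v w = φ x w • θ' v + φ' v w • θ x := by
  refine ⟨_, (ContinuousLinearMap.smulRightL ℝ V F).hasFDerivAt_of_bilinear hφ hθ, fun v w => ?_⟩
  simp

/-- `d(dχ ∧ θ) = -dχ ∧ dθ`. -/
theorem extDeriv_wedgeOne_fderiv {χ : V → ℝ} {x : V} (hχ : ContDiffAt ℝ 2 χ x)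
    {θ : V → V [⋀^Fin k]→L[ℝ] ℝ} (hθ : DifferentiableAt ℝ θ x) :
    extDeriv (fun y => wedgeOne (fderiv ℝ χ y) (θ y)) x
      = -wedgeOne (fderiv ℝ χ x) (extDeriv θ x) := by
  have hφ : HasFDerivAt (fderiv ℝ χ) (fderiv ℝ (fderiv ℝ χ) x) x :=
    ((hχ.fderiv_right (m := 1) (by norm_num)).differentiableAt (by norm_num)).hasFDerivAt
  obtain ⟨D, hD, hDv⟩ := exists_hasFDerivAt_smulRight hφ hθ.hasFDerivAt
  have h2 := (alternatizeUncurryFinCLM ℝ V ℝ (n := k)).hasFDerivAt.comp x hD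
  have h3 : extDeriv (fun y => wedgeOne (fderiv ℝ χ y) (θ y)) x
      = alternatizeUncurryFin (alternatizeUncurryFinCLM ℝ V ℝ ∘L D) := congrArg _ h2.fderiv
  -- `D` plus the swap of its first term is symmetric in its two arguments
  have hsymm : alternatizeUncurryFin (alternatizeUncurryFinCLM ℝ V ℝ ∘L
      (D + (fderiv ℝ χ x).smulRight (fderiv ℝ θ x))) = 0 := by
    refine ContinuousAlternatingMap.alternatizeUncurryFin_alternatizeUncurryFinCLM_comp_of_symmetric
      fun v w => ?_
    have := hχ.isSymmSndFDerivAt (by simp) v w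
    simp only [add_apply, hDv, ContinuousLinearMap.smulRight_apply, smul_apply, this]
    abel
  rw [ContinuousLinearMap.comp_add, ContinuousAlternatingMap.alternatizeUncurryFin_add, ← h3]
    at hsymm
  rw [eq_neg_of_add_eq_zero_left hsymm, wedgeOne, extDeriv]
  congr 2
  ext v
  simp

end Calculus

/-! ### The differentials of the Pfaffian, the transgression form and the Gaussian form -/

/-- The moment `∫₀^∞ t^k exp(-t²) dt`. -/
noncomputable def gaussMoment (k : ℕ) : ℝ := Real.Gamma (((k : ℝ) + 1) / 2) / 2

/-- The functional equation of `Γ`. -/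
theorem gaussMoment_add_two (k : ℕ) : 2 * gaussMoment (k + 2) = ((k : ℝ) + 1) * gaussMoment k := by
  have h : (((k + 2 : ℕ) : ℝ) + 1) / 2 = ((k : ℝ) + 1) / 2 + 1 := by push_cast; ring
  rw [gaussMoment, h, Real.Gamma_add_one (by positivity), gaussMoment]
  ring

theorem gaussMoment_one : gaussMoment 1 = 1 / 2 := by
  rw [gaussMoment]
  norm_num

theorem integral_exp_mul_pow (k : ℕ) {r : ℝ} (hr : 0 < r) :
    ∫ t in Ioi (0 : ℝ), Real.exp (-(t ^ 2 * r ^ 2)) * t ^ k = gaussMoment k * r⁻¹ ^ (k + 1) := by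
  have h := integral_rpow_mul_exp_neg_mul_rpow (p := 2) (q := (k : ℝ)) (b := r ^ 2) (by norm_num)
    (by linarith [(Nat.cast_nonneg k : (0 : ℝ) ≤ k)]) (by positivity)
  have e : ∀ t ∈ Ioi (0 : ℝ), Real.exp (-(t ^ 2 * r ^ 2)) * t ^ k
      = t ^ (k : ℝ) * Real.exp (-r ^ 2 * t ^ (2 : ℝ)) := by
    intro t _
    rw [Real.rpow_natCast, Real.rpow_two, mul_comm]
    congr 2
    ring
  rw [setIntegral_congr_fun measurableSet_Ioi e, h, gaussMoment]
  have e2 : (r ^ 2) ^ (-((k : ℝ) + 1) / 2) = r⁻¹ ^ (k + 1) := by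
    rw [← Real.rpow_natCast r 2, ← Real.rpow_mul hr.le, inv_pow, ← Real.rpow_natCast,
      ← Real.rpow_neg hr.le]
    congr 1
    push_cast
    ring
  rw [e2]
  ring

theorem integrableOn_exp_mul_pow (k : ℕ) {r : ℝ} (hr : 0 < r) :
    IntegrableOn (fun t : ℝ => Real.exp (-(t ^ 2 * r ^ 2)) * t ^ k) (Ioi 0) := by
  have h := integrableOn_rpow_mul_exp_neg_mul_sq (b := r ^ 2) (by positivity) (s := (k : ℝ))
    (by linarith [(Nat.cast_nonneg k : (0 : ℝ) ≤ k)])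
  refine h.congr_fun (fun t _ => ?_) measurableSet_Ioi
  simp only [Real.rpow_natCast]
  rw [mul_comm]
  congr 2
  ring

theorem hasFDerivAt_inv_norm_pow {x : V} (hx : x ≠ 0) (n : ℕ) :
    HasFDerivAt (fun y : V => ‖y‖⁻¹ ^ n) ((-(n : ℝ) * ‖x‖⁻¹ ^ (n + 2)) • innerSL ℝ x) x := by
  have hpos : 0 < ‖x‖ := norm_pos_iff.2 hx
  have h1 : HasFDerivAt (fun y : V => ‖y‖ ^ 2) (2 • innerSL ℝ x) x :=
    (hasStrictFDerivAt_norm_sq x).hasFDerivAt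
  have h2 := h1.sqrt (by positivity)
  have h3 : HasFDerivAt (fun y : V => ‖y‖) (‖x‖⁻¹ • innerSL ℝ x) x := by
    have e : (fun y : V => √(‖y‖ ^ 2)) = fun y => ‖y‖ := by
      funext y
      exact Real.sqrt_sq (norm_nonneg y)
    rw [e, Real.sqrt_sq (norm_nonneg x)] at h2
    convert! h2 using 1
    ext v
    simp
    field_simp
  have h4 := ((hasDerivAt_inv hpos.ne').pow n).comp_hasFDerivAt x h3
  convert! h4 using 1
  rw [smul_smul]
  congr 1
  cases n with
  | zero => simp
  | succ n =>
    simp only [Nat.add_sub_cancel, inv_pow]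
    field_simp
    ring

theorem hasFDerivAt_gaussMoment_inv_norm_pow (k : ℕ) {x : V} (hx : x ≠ 0) :
    HasFDerivAt (fun y : V => -(gaussMoment k) * ‖y‖⁻¹ ^ (k + 1))
      ((((k : ℝ) + 1) * gaussMoment k * ‖x‖⁻¹ ^ (k + 3)) • innerSL ℝ x) x := by
  have h := (hasFDerivAt_inv_norm_pow hx (k + 1)).const_mul (-(gaussMoment k))
  convert! h using 1
  rw [smul_smul]
  congr 1
  push_cast
  ring

theorem contract_vectorField (X : so V) (θ : MForm V) (k : ℕ) (x : V) :
    contract (vectorField X) θ k x = -(θ (k + 1) x).curryLeft ((X : Module.End ℝ V) x) := by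
  rw [contract, vectorField, map_neg]

theorem curryLeft_comm {k : ℕ} (θ : V [⋀^Fin (k + 2)]→L[ℝ] ℝ) (x y : V) :
    (θ.curryLeft x).curryLeft y = -(θ.curryLeft y).curryLeft x := by
  have h := θ.curryLeft_same (x + y)
  simp only [map_add, ContinuousAlternatingMap.curryLeft_add, add_apply,
    ContinuousAlternatingMap.curryLeft_same, zero_add, add_zero] at h
  exact eq_neg_of_add_eq_zero_right h

/-- A constant function is equivariantly closed. -/
theorem equivD_pfForm {d : ℕ} (b : OrthonormalBasis (Fin d) ℝ V) (X : so V) (k : ℕ) (x : V) :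
    equivD (pfForm b) X k x = 0 := by
  have h1 : contract (vectorField X) (pfForm b X) k x = 0 := by
    rw [contract_vectorField]
    simp [pfForm]
  cases k with
  | zero =>
    change (0 : V [⋀^Fin 0]→L[ℝ] ℝ) - contract (vectorField X) (pfForm b X) 0 x = 0
    rw [h1, sub_zero]
  | succ k =>
    change extDeriv (pfForm b X k) x - contract (vectorField X) (pfForm b X) (k + 1) x = 0
    rw [h1, sub_zero, extDeriv]
    cases k with
    | zero =>
      simp only [pfForm, fderiv_fun_const]
      exact map_zero (alternatizeUncurryFinCLM ℝ V ℝ)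
    | succ k =>
      simp only [pfForm, Pi.zero_def, fderiv_fun_const]
      exact map_zero (alternatizeUncurryFinCLM ℝ V ℝ)

section Beta

variable [FiniteDimensional ℝ V] {d : ℕ} (b : OrthonormalBasis (Fin d) ℝ V)

/-- Absolute convergence of the integral defining `β_∧` away from the origin. -/
theorem integrableOn_etaForm (X : so V) (k : ℕ) {x : V} (hx : x ≠ 0) :
    IntegrableOn (fun t : ℝ => etaForm b t X k x) (Ioi 0) := by
  simp only [etaForm_eq]
  exact ((integrableOn_exp_mul_pow k (norm_pos_iff.2 hx)).smul_const _).neg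

theorem betaForm_eq (X : so V) (k : ℕ) (x : V) : betaForm b X k x
    = (-(gaussMoment k) * ‖x‖⁻¹ ^ (k + 1)) • (thomCoeff b X (k + 1)).curryLeft x := by
  by_cases hx : x = 0
  · simp [betaForm, res, hx]
  · have hx' : x ∈ ({0}ᶜ : Set V) := hx
    rw [betaForm, res, indicator_of_mem hx']
    simp only [etaForm_eq]
    rw [integral_neg, integral_smul_const, integral_exp_mul_pow k (norm_pos_iff.2 hx), ← neg_smul,
      neg_mul]

theorem differentiableAt_betaForm (X : so V) (k : ℕ) {x : V} (hx : x ≠ 0) :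
    DifferentiableAt ℝ (betaForm b X k) x := by
  rw [show betaForm b X k = _ from funext fun y => betaForm_eq b X k y]
  exact (hasFDerivAt_smul_curryLeft (hasFDerivAt_gaussMoment_inv_norm_pow k hx) _).differentiableAt

/-- `ι(Xx) ι(x) C_{k+2} = -2 ι(x) (λ ∧ C_k)`. -/
theorem curryLeft_so_thomCoeff (X : so V) (x : V) (k : ℕ) :
    ((thomCoeff b X (k + 2)).curryLeft x).curryLeft ((X : Module.End ℝ V) x)
      = -((2 : ℝ) • (wedgeOne (innerSL ℝ x) (thomCoeff b X k)).curryLeft x) := by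
  rw [curryLeft_comm, wedgeOne_thomCoeff, ContinuousAlternatingMap.curryLeft_smul, smul_apply,
    smul_smul]
  norm_num

theorem contract_betaForm (X : so V) (k : ℕ) (x : V) :
    contract (vectorField X) (betaForm b X) k x
      = (-2 * gaussMoment (k + 1) * ‖x‖⁻¹ ^ (k + 2)) •
        (wedgeOne (innerSL ℝ x) (thomCoeff b X k)).curryLeft x := by
  rw [contract_vectorField, betaForm_eq, ContinuousAlternatingMap.curryLeft_smul, smul_apply,
    curryLeft_so_thomCoeff]
  module

/-- The transgression form is a primitive of the Pfaffian away from the origin. -/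
theorem equivD_betaForm (X : so V) (k : ℕ) {x : V} (hx : x ≠ 0) :
    equivD (betaForm b) X k x = pfForm b X k x := by
  have hpos : 0 < ‖x‖ := norm_pos_iff.2 hx
  cases k with
  | zero =>
    change (0 : V [⋀^Fin 0]→L[ℝ] ℝ) - contract (vectorField X) (betaForm b X) 0 x = _
    rw [contract_betaForm, curryLeft_wedgeOne_zero, innerSL_apply_apply,
      real_inner_self_eq_norm_sq, gaussMoment_one, zero_sub, smul_smul, pfForm, ← thomCoeff_zero]
    have : -2 * (1 / 2 : ℝ) * ‖x‖⁻¹ ^ (0 + 2) * ‖x‖ ^ 2 = -1 := by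
      rw [zero_add, inv_pow]
      field_simp
    rw [this]
    module
  | succ k =>
    change extDeriv (betaForm b X k) x - contract (vectorField X) (betaForm b X) (k + 1) x = 0
    rw [show betaForm b X k = _ from funext fun y => betaForm_eq b X k y,
      extDeriv_smul_curryLeft (hasFDerivAt_gaussMoment_inv_norm_pow k hx), contract_betaForm,
      curryLeft_wedgeOne_succ, innerSL_apply_apply, real_inner_self_eq_norm_sq,
      wedgeOne_smul_left, smul_sub, smul_smul]
    have h1 : -2 * gaussMoment (k + 1 + 1) = -(((k : ℝ) + 1) * gaussMoment k) := by
      rw [← gaussMoment_add_two]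
      ring
    have h2 : ‖x‖⁻¹ ^ (k + 1 + 2) * ‖x‖ ^ 2 = ‖x‖⁻¹ ^ (k + 1) := by
      rw [pow_add, mul_assoc, ← mul_pow, inv_mul_cancel₀ hpos.ne', one_pow, mul_one]
    rw [h1, mul_assoc _ _ (‖x‖ ^ 2), h2]
    module

/-- The Gaussian form is closed. -/
theorem equivD_cForm (X : so V) (k : ℕ) (x : V) : equivD (cForm b 1) X k x = 0 := by
  have h0 : ∀ k y, cForm b 1 X k y = Real.exp (-‖y‖ ^ 2) • thomCoeff b X k := by
    intro k y
    rw [cForm_eq]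
    simp
  cases k with
  | zero =>
    change (0 : V [⋀^Fin 0]→L[ℝ] ℝ) - contract (vectorField X) (cForm b 1 X) 0 x = 0
    rw [contract_vectorField, h0, ContinuousAlternatingMap.curryLeft_smul, smul_apply,
      thomCoeff_one_curryLeft]
    simp
  | succ k =>
    change extDeriv (cForm b 1 X k) x - contract (vectorField X) (cForm b 1 X) (k + 1) x = 0
    have h1 : HasFDerivAt (fun y : V => ‖y‖ ^ 2) (2 • innerSL ℝ x) x :=
      (hasStrictFDerivAt_norm_sq x).hasFDerivAt
    have h4 : HasFDerivAt (fun y : V => Real.exp (-‖y‖ ^ 2))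
        ((-2 * Real.exp (-‖x‖ ^ 2)) • innerSL ℝ x) x := by
      convert! h1.neg.exp using 1
      ext v
      simp
      ring
    rw [show cForm b 1 X k = _ from funext fun y => h0 k y, extDeriv_smul_const h4,
      contract_vectorField, h0, ContinuousAlternatingMap.curryLeft_smul, smul_apply,
      wedgeOne_smul_left]
    have h2 : (thomCoeff b X (k + 2)).curryLeft ((X : Module.End ℝ V) x)
        = (2 : ℝ) • wedgeOne (innerSL ℝ x) (thomCoeff b X k) := by
      rw [wedgeOne_thomCoeff, smul_smul]
      norm_num
    rw [h2]
    module

end Beta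

/-! ### Rapid decrease of the Gaussian -/

section Gaussian

theorem norm_iteratedFDeriv_id_le (n : ℕ) (x : V) :
    ‖iteratedFDeriv ℝ n (fun y : V => y) x‖ ≤ 1 + ‖x‖ := by
  cases n with
  | zero => simp
  | succ n =>
    rw [← norm_iteratedFDeriv_fderiv]
    have h : fderiv ℝ (fun y : V => y) = fun _ => ContinuousLinearMap.id ℝ V := by
      funext y
      exact fderiv_fun_id
    rw [h]
    cases n with
    | zero =>
      rw [norm_iteratedFDeriv_zero]
      linarith [ContinuousLinearMap.norm_id_le (𝕜 := ℝ) (E := V), norm_nonneg x]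
    | succ n =>
      rw [iteratedFDeriv_const_of_ne n.succ_ne_zero]
      simp only [Pi.zero_apply, norm_zero]
      positivity

/-- All derivatives of `‖·‖²` grow at most quadratically. -/
theorem norm_iteratedFDeriv_norm_sq_le (n : ℕ) (x : V) :
    ‖iteratedFDeriv ℝ n (fun y : V => ‖y‖ ^ 2) x‖ ≤ 2 ^ n * (1 + ‖x‖) ^ 2 := by
  let B : V →L[ℝ] V →L[ℝ] ℝ := (innerₗ V).mkContinuous₂ 1 fun y z => by
    simpa using norm_inner_le_norm (𝕜 := ℝ) y z
  have hB : ‖B‖ ≤ 1 := LinearMap.mkContinuous₂_norm_le _ zero_le_one _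
  have h := B.norm_iteratedFDeriv_le_of_bilinear_of_le_one
    (f := fun y : V => y) (g := fun y : V => y) (N := (⊤ : ℕ∞)) contDiff_id contDiff_id x
    (n := n) (by exact_mod_cast le_top) hB
  have e : (fun y : V => B y y) = fun y => ‖y‖ ^ 2 := by
    funext y
    exact real_inner_self_eq_norm_sq y
  rw [e] at h
  refine h.trans ?_
  have hs : (∑ i ∈ Finset.range (n + 1), (n.choose i : ℝ)) = 2 ^ n := by
    exact_mod_cast Nat.sum_range_choose n
  rw [← hs, Finset.sum_mul]
  refine Finset.sum_le_sum fun i _ => ?_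
  rw [mul_assoc, sq]
  gcongr
  · exact norm_iteratedFDeriv_id_le i x
  · exact norm_iteratedFDeriv_id_le (n - i) x

theorem contDiff_exp_neg_norm_sq : ContDiff ℝ ∞ fun x : V => Real.exp (-‖x‖ ^ 2) :=
  (contDiff_norm_sq ℝ).neg.exp

/-- The derivatives of the Gaussian decrease rapidly: by the formula of Faà di Bruno they are
bounded by a polynomial in `‖x‖` times the Gaussian. -/
theorem exists_norm_iteratedFDeriv_gaussian_le (m n : ℕ) : ∃ C : ℝ, ∀ x : V,
    ‖x‖ ^ m * ‖iteratedFDeriv ℝ n (fun y : V => Real.exp (-‖y‖ ^ 2)) x‖ ≤ C := by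
  set N := m + 2 * n with hN
  refine ⟨n.factorial * 2 ^ n * (N.factorial * Real.exp 2), fun x => ?_⟩
  have hder : ‖iteratedFDeriv ℝ n (Real.exp ∘ fun y : V => -‖y‖ ^ 2) x‖
      ≤ n.factorial * Real.exp (-‖x‖ ^ 2) * (2 * (1 + ‖x‖) ^ 2) ^ n := by
    refine norm_iteratedFDeriv_comp_le (N := (⊤ : ℕ∞)) Real.contDiff_exp (contDiff_norm_sq ℝ).neg
      (by exact_mod_cast le_top) x (fun i _ => ?_) fun i hi _ => ?_
    · rw [norm_iteratedFDeriv_eq_norm_iteratedDeriv, iteratedDeriv_eq_iterate, Real.iter_deriv_exp,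
        Real.norm_of_nonneg (Real.exp_pos _).le]
    · have e : iteratedFDeriv ℝ i (fun y : V => -‖y‖ ^ 2) x
          = -iteratedFDeriv ℝ i (fun y : V => ‖y‖ ^ 2) x := iteratedFDeriv_neg_apply
      rw [e, norm_neg, mul_pow]
      refine (norm_iteratedFDeriv_norm_sq_le i x).trans ?_
      gcongr
      exact le_self_pow₀ (by nlinarith [norm_nonneg x]) (by omega)
  have hs : (1 + ‖x‖) ^ N ≤ N.factorial * Real.exp 2 * Real.exp (‖x‖ ^ 2) := by
    have h1 := Real.pow_div_factorial_le_exp (1 + ‖x‖) (by positivity) N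
    have h2 : Real.exp (1 + ‖x‖) ≤ Real.exp 2 * Real.exp (‖x‖ ^ 2) := by
      rw [← Real.exp_add]
      exact Real.exp_le_exp.2 (by nlinarith [sq_nonneg (‖x‖ - 1), sq_nonneg ‖x‖])
    rw [div_le_iff₀ (by positivity)] at h1
    nlinarith [h1, h2, (by positivity : (0 : ℝ) < N.factorial)]
  have hx : ‖x‖ ^ m * (1 + ‖x‖) ^ (2 * n) ≤ (1 + ‖x‖) ^ N := by
    rw [hN, pow_add]
    gcongr
    linarith
  calc ‖x‖ ^ m * ‖iteratedFDeriv ℝ n (fun y : V => Real.exp (-‖y‖ ^ 2)) x‖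
      ≤ ‖x‖ ^ m * (n.factorial * Real.exp (-‖x‖ ^ 2) * (2 * (1 + ‖x‖) ^ 2) ^ n) := by
        gcongr
        exact hder
    _ = n.factorial * 2 ^ n * Real.exp (-‖x‖ ^ 2) * (‖x‖ ^ m * (1 + ‖x‖) ^ (2 * n)) := by
        rw [mul_pow, ← pow_mul]
        ring
    _ ≤ n.factorial * 2 ^ n * Real.exp (-‖x‖ ^ 2)
        * (N.factorial * Real.exp 2 * Real.exp (‖x‖ ^ 2)) := by
        exact mul_le_mul_of_nonneg_left (hx.trans hs) (by positivity)
    _ = n.factorial * 2 ^ n * (N.factorial * Real.exp 2)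
        * (Real.exp (-‖x‖ ^ 2) * Real.exp (‖x‖ ^ 2)) := by ring
    _ = _ := by rw [← Real.exp_add]; simp

end Gaussian

/-! ### Membership in the complexes, and closedness of the cut-off form -/

section Membership

variable {χ : V → ℝ}

/-- The transgression form as a linear function of the constant forms `C_k(X)`. -/
noncomputable def betaLinear (k : ℕ) (x : V) :
    (∀ j : ℕ, V [⋀^Fin j]→L[ℝ] ℝ) →ₗ[ℝ] V [⋀^Fin k]→L[ℝ] ℝ where
  toFun c := (-(gaussMoment k) * ‖x‖⁻¹ ^ (k + 1)) • (c (k + 1)).curryLeft x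
  map_add' c c' := by
    rw [Pi.add_apply, ContinuousAlternatingMap.curryLeft_add, add_apply, smul_add]
  map_smul' r c := by
    rw [Pi.smul_apply, ContinuousAlternatingMap.curryLeft_smul, smul_apply, smul_comm,
      RingHom.id_apply]

theorem contDiffAt_betaLinear (c : ∀ j : ℕ, V [⋀^Fin j]→L[ℝ] ℝ) (k : ℕ) {x : V} (hx : x ≠ 0) :
    ContDiffAt ℝ ∞ (fun y => betaLinear k y c) x := by
  have h1 : ContDiffAt ℝ ∞ (fun y : V => ‖y‖⁻¹) x :=
    (contDiffAt_norm ℝ hx).inv (norm_ne_zero_iff.2 hx)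
  exact (contDiffAt_const.mul (h1.pow _)).smul (c (k + 1)).curryLeft.contDiff.contDiffAt

theorem wedgeOne_compContinuousLinearMap {k : ℕ} (φ : V →L[ℝ] ℝ) (θ : V [⋀^Fin k]→L[ℝ] ℝ)
    (g : V →L[ℝ] V) : (wedgeOne φ θ).compContinuousLinearMap g
      = wedgeOne (φ.comp g) (θ.compContinuousLinearMap g) := by
  ext v
  simp only [ContinuousAlternatingMap.compContinuousLinearMap_apply, wedgeOne_apply]
  rfl

theorem IsCutoff.fderiv_eventually_eq_zero (hχ : IsCutoff χ) :
    ∀ᶠ x in 𝓝 (0 : V), fderiv ℝ χ x = 0 := by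
  filter_upwards [hχ.eventually_eq_one.eventually_nhds] with x hx
  have : χ =ᶠ[𝓝 x] fun _ => (1 : ℝ) := hx
  rw [this.fderiv_eq]
  simp

/-- The singularity of `β_∧` at the origin does not matter, since `dχ` vanishes near it. -/
theorem contDiff_wedgeOne_fderiv_betaLinear (hχ : IsCutoff χ)
    (c : ∀ j : ℕ, V [⋀^Fin j]→L[ℝ] ℝ) (k : ℕ) :
    ContDiff ℝ ∞ fun x => wedgeOne (fderiv ℝ χ x) (betaLinear k x c) := by
  rw [contDiff_iff_contDiffAt]
  intro x
  by_cases hx : x = 0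
  · subst hx
    have h : (fun x => wedgeOne (fderiv ℝ χ x) (betaLinear k x c))
        =ᶠ[𝓝 (0 : V)] fun _ => 0 := by
      filter_upwards [hχ.fderiv_eventually_eq_zero] with x hx
      rw [hx, wedgeOne_zero_left]
    exact contDiffAt_const.congr_of_eventuallyEq h
  · have h1 : ContDiffAt ℝ ∞ (fderiv ℝ χ) x :=
      (hχ.contDiff.fderiv_right (m := ∞) (by simp)).contDiffAt
    exact (alternatizeUncurryFinCLM ℝ V ℝ).contDiff.contDiffAt.comp x
      (h1.smulRight (contDiffAt_betaLinear c k hx))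

/-- The form `χ α + dχ ∧ β_∧` as a linear function of the constant forms `C_k(X)`. -/
noncomputable def cutoffLinear (χ : V → ℝ) : ∀ (k : ℕ) (_ : V),
    (∀ j : ℕ, V [⋀^Fin j]→L[ℝ] ℝ) →ₗ[ℝ] V [⋀^Fin k]→L[ℝ] ℝ
  | 0, x => χ x • LinearMap.proj 0
  | k + 1, x =>
    { toFun := fun c => wedgeOne (fderiv ℝ χ x) (betaLinear k x c)
      map_add' := fun c c' => by rw [map_add, wedgeOne_add_right]
      map_smul' := fun r c => by rw [map_smul, wedgeOne_smul_right]; rfl }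

theorem equivD_congr {α β : EForm V} {X : so V} {x : V} (h : ∀ k, α X k =ᶠ[𝓝 x] β X k) (k : ℕ) :
    equivD α X k x = equivD β X k x := by
  have h1 : contract (vectorField X) (α X) k x = contract (vectorField X) (β X) k x := by
    rw [contract, contract, (h (k + 1)).eq_of_nhds]
  cases k with
  | zero =>
    change (0 : V [⋀^Fin 0]→L[ℝ] ℝ) - contract (vectorField X) (α X) 0 x
      = 0 - contract (vectorField X) (β X) 0 x
    rw [h1]
  | succ k =>
    change extDeriv (α X k) x - contract (vectorField X) (α X) (k + 1) x
      = extDeriv (β X k) x - contract (vectorField X) (β X) (k + 1) x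
    rw [h1, extDeriv, extDeriv, (h k).fderiv_eq]

variable [FiniteDimensional ℝ V] {d : ℕ} (b : OrthonormalBasis (Fin d) ℝ V)

theorem pfForm_mem_Apol : pfForm b ∈ Apol V univ := by
  constructor
  · let G : ∀ k, V → (∀ j : ℕ, V [⋀^Fin j]→L[ℝ] ℝ) →ₗ[ℝ] V [⋀^Fin k]→L[ℝ] ℝ := fun k _ =>
      match k with
      | 0 => LinearMap.proj 0
      | _ + 1 => 0
    have h : pfForm b = fun X k x => G k x (thomCoeff b X) := by
      funext X k x
      cases k with
      | zero => exact (thomCoeff_zero b X).symm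
      | succ k => rfl
    rw [h]
    refine mem_polyForms_of_thomCoeff b G fun c k => ⟨?_, fun x hx => (hx (mem_univ x)).elim⟩
    cases k <;> exact contDiffOn_const
  · intro g hg X k x
    cases k with
    | zero =>
      have := thomCoeff_Ad b hg X 0
      rw [thomCoeff_zero, thomCoeff_zero] at this
      exact this
    | succ k => rfl

theorem cForm_one_eq (X : so V) (k : ℕ) (x : V) :
    cForm b 1 X k x = Real.exp (-‖x‖ ^ 2) • thomCoeff b X k := by
  rw [cForm_eq]
  simp

theorem cForm_mem_ApolDR : cForm b 1 ∈ ApolDR V := by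
  refine ⟨⟨?_, ?_⟩, fun X k => ⟨?_, fun m n => ?_⟩⟩
  · have h : cForm b 1 = fun X k x =>
        (Real.exp (-‖x‖ ^ 2) • LinearMap.proj k : (∀ j : ℕ, V [⋀^Fin j]→L[ℝ] ℝ) →ₗ[ℝ] _)
          (thomCoeff b X) := by
      funext X k x
      exact cForm_one_eq b X k x
    rw [h]
    exact mem_polyForms_of_thomCoeff b _ fun c k =>
      ⟨(contDiff_exp_neg_norm_sq.smul contDiff_const).contDiffOn,
        fun x hx => (hx (mem_univ x)).elim⟩
  · intro g hg X k x
    rw [cForm_one_eq, cForm_one_eq, ← thomCoeff_Ad b hg X k, g.norm_map]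
    rfl
  · rw [show cForm b 1 X k = _ from funext (cForm_one_eq b X k)]
    exact contDiff_exp_neg_norm_sq.smul contDiff_const
  · obtain ⟨C, hC⟩ := exists_norm_iteratedFDeriv_gaussian_le (V := V) m n
    refine ⟨‖thomCoeff b X k‖ * C, fun x => ?_⟩
    rw [show cForm b 1 X k = _ from funext (cForm_one_eq b X k)]
    let L := ContinuousLinearMap.toSpanSingleton ℝ (thomCoeff b X k)
    have h := L.norm_iteratedFDeriv_comp_left
      (f := fun y : V => Real.exp (-‖y‖ ^ 2)) (x := x) (N := (⊤ : ℕ∞)) (n := n)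
      contDiff_exp_neg_norm_sq.contDiffAt (by exact_mod_cast le_top)
    rw [ContinuousLinearMap.norm_toSpanSingleton] at h
    calc ‖x‖ ^ m * ‖iteratedFDeriv ℝ n (fun y => Real.exp (-‖y‖ ^ 2) • thomCoeff b X k) x‖
        ≤ ‖x‖ ^ m * (‖thomCoeff b X k‖
            * ‖iteratedFDeriv ℝ n (fun y : V => Real.exp (-‖y‖ ^ 2)) x‖) := by
          gcongr
          exact h
      _ = ‖thomCoeff b X k‖
            * (‖x‖ ^ m * ‖iteratedFDeriv ℝ n (fun y : V => Real.exp (-‖y‖ ^ 2)) x‖) := by ring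
      _ ≤ _ := by
          gcongr
          exact hC x

theorem betaLinear_thomCoeff (X : so V) (k : ℕ) (x : V) :
    betaLinear k x (thomCoeff b X) = betaForm b X k x := (betaForm_eq b X k x).symm

theorem betaForm_equivariant : betaForm b ∈ equivariantMaps V := by
  intro g hg X k x
  rw [betaForm_eq, betaForm_eq, ← thomCoeff_Ad b hg X (k + 1),
    ContinuousAlternatingMap.curryLeft_compContinuousLinearMap, g.norm_map]
  rfl

theorem betaForm_mem_Apol : betaForm b ∈ Apol V {0}ᶜ := by
  refine ⟨?_, betaForm_equivariant b⟩
  have h : betaForm b = fun X k x => betaLinear k x (thomCoeff b X) := by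
    funext X k x
    exact (betaLinear_thomCoeff b X k x).symm
  rw [h]
  refine mem_polyForms_of_thomCoeff b _ fun c k => ⟨fun x hx => ?_, fun x hx => ?_⟩
  · exact (contDiffAt_betaLinear c k hx).contDiffWithinAt
  · obtain rfl : x = 0 := by simpa using hx
    simp [betaLinear]

theorem cutoffLinear_thomCoeff (X : so V) (k : ℕ) (x : V) :
    cutoffLinear χ k x (thomCoeff b X) = cutoffForm χ (pfForm b) (betaForm b) X k x := by
  cases k with
  | zero =>
    change χ x • thomCoeff b X 0 = χ x • pfForm b X 0 x
    rw [thomCoeff_zero]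
    rfl
  | succ k =>
    change wedgeOne (fderiv ℝ χ x) (betaLinear k x (thomCoeff b X))
      = χ x • (0 : V [⋀^Fin (k + 1)]→L[ℝ] ℝ) + wedgeOne (fderiv ℝ χ x) (betaForm b X k x)
    rw [betaLinear_thomCoeff, smul_zero, zero_add]

theorem cutoffForm_mem_ApolC (hχ : IsCutoff χ) :
    cutoffForm χ (pfForm b) (betaForm b) ∈ ApolC V := by
  constructor
  · have h : cutoffForm χ (pfForm b) (betaForm b)
        = fun X k x => cutoffLinear χ k x (thomCoeff b X) := by
      funext X k x
      exact (cutoffLinear_thomCoeff b X k x).symm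
    rw [h]
    refine mem_polyForms_of_thomCoeff b _ fun c k => ?_
    cases k with
    | zero => exact ⟨hχ.contDiff.smul contDiff_const, hχ.hasCompactSupport.smul_right⟩
    | succ k =>
      refine ⟨contDiff_wedgeOne_fderiv_betaLinear hχ c k,
        (hχ.hasCompactSupport.fderiv (𝕜 := ℝ)).mono fun x hx h0 => hx ?_⟩
      change wedgeOne (fderiv ℝ χ x) (betaLinear k x c) = 0
      rw [h0, wedgeOne_zero_left]
  · intro g hg X k x
    cases k with
    | zero =>
      change (χ (g x) • pfForm b (Ad g X) 0 (g x)).compContinuousLinearMap _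
        = χ x • pfForm b X 0 x
      rw [hχ.invariant g hg, ← (pfForm_mem_Apol b).2 g hg X 0 x]
      rfl
    | succ k =>
      have h : ∀ (Y : so V) (y : V), cutoffForm χ (pfForm b) (betaForm b) Y (k + 1) y
          = wedgeOne (fderiv ℝ χ y) (betaForm b Y k y) := by
        intro Y y
        rw [← cutoffLinear_thomCoeff, ← betaLinear_thomCoeff]
        rfl
      rw [h, h, wedgeOne_compContinuousLinearMap, fderiv_comp_of_invariant hχ.invariant hg,
        betaForm_equivariant b g hg X k x]

/-- Away from the origin, `D(χ Pf + dχ ∧ β) = dχ ∧ Pf - dχ ∧ Dβ = 0` because `dχ` vanishes on `VX`;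
near the origin the form is the constant `Pf`. -/
theorem equivD_cutoffForm (hχ : IsCutoff χ) (X : so V) (k : ℕ) (x : V) :
    equivD (cutoffForm χ (pfForm b) (betaForm b)) X k x = 0 := by
  set γ := cutoffForm χ (pfForm b) (betaForm b) with hγ
  have h0 : ∀ y, γ X 0 y = χ y • thomCoeff b X 0 := fun y =>
    (cutoffLinear_thomCoeff b X 0 y).symm
  have hs : ∀ k y, γ X (k + 1) y = wedgeOne (fderiv ℝ χ y) (betaForm b X k y) := by
    intro k y
    rw [hγ, ← cutoffLinear_thomCoeff, ← betaLinear_thomCoeff]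
    rfl
  by_cases hx : x = 0
  · subst hx
    rw [equivD_congr (β := pfForm b) (fun k => ?_), equivD_pfForm]
    filter_upwards [hχ.fderiv_eventually_eq_zero, hχ.eventually_eq_one] with y hy hy1
    cases k with
    | zero => rw [h0, hy1, one_smul, thomCoeff_zero, pfForm]
    | succ k =>
      rw [hs, hy, wedgeOne_zero_left]
      rfl
  have hdχ : fderiv ℝ χ x ((X : Module.End ℝ V) x) = 0 :=
    fderiv_apply_so_of_invariant hχ.invariant (hχ.contDiff.differentiable (by simp) x) X
  cases k with
  | zero =>
    change (0 : V [⋀^Fin 0]→L[ℝ] ℝ) - contract (vectorField X) (γ X) 0 x = 0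
    rw [contract_vectorField, hs, curryLeft_wedgeOne_zero, hdχ]
    simp
  | succ k =>
    change extDeriv (γ X k) x - contract (vectorField X) (γ X) (k + 1) x = 0
    have hβ := equivD_betaForm b X k hx
    rw [contract_vectorField, hs, curryLeft_wedgeOne_succ, hdχ, zero_smul, zero_sub, neg_neg]
    cases k with
    | zero =>
      change (0 : V [⋀^Fin 0]→L[ℝ] ℝ) - contract (vectorField X) (betaForm b X) 0 x
        = pfForm b X 0 x at hβ
      rw [contract_vectorField, sub_neg_eq_add, zero_add] at hβ
      rw [hβ, show γ X 0 = _ from funext h0,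
        extDeriv_smul_const (hχ.contDiff.differentiable (by simp) x).hasFDerivAt, thomCoeff_zero]
      exact sub_self _
    | succ k =>
      change extDeriv (betaForm b X k) x - contract (vectorField X) (betaForm b X) (k + 1) x
        = 0 at hβ
      rw [contract_vectorField, sub_neg_eq_add] at hβ
      rw [show γ X (k + 1) = _ from funext (hs k), extDeriv_wedgeOne_fderiv
        (contDiff_infty.1 hχ.contDiff 2).contDiffAt
        (differentiableAt_betaForm b X k hx), eq_neg_of_add_eq_zero_left hβ, wedgeOne_neg_right,
        neg_neg, sub_self]

end Membership

/-! ### Polar coordinates -/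

section Polar

variable {χ : V → ℝ}

/-- Along each ray, `χ` goes from `1` to `0`. -/
theorem IsCutoff.integral_radial_deriv (hχ : IsCutoff χ) {θ : V} (hθ : ‖θ‖ = 1) :
    ∫ r in Ioi (0 : ℝ), fderiv ℝ χ (r • θ) θ = -1 := by
  have hθ0 : θ ≠ 0 := by
    rintro rfl
    simp at hθ
  have hd : ∀ r : ℝ, deriv (fun r : ℝ => χ (r • θ)) r = fderiv ℝ χ (r • θ) θ := by
    intro r
    have h1 : HasDerivAt (fun r : ℝ => r • θ) θ r := by
      simpa using (hasDerivAt_id r).smul_const θ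
    exact ((hχ.contDiff.differentiable (by simp) (r • θ)).hasFDerivAt.comp_hasDerivAt r h1).deriv
  have h := HasCompactSupport.integral_Ioi_deriv_eq (f := fun r : ℝ => χ (r • θ))
    ((contDiff_infty.1 hχ.contDiff 1).comp (contDiff_id.smul contDiff_const))
    (hχ.hasCompactSupport.comp_isClosedEmbedding (isClosedEmbedding_smul_left hθ0)) 0
  simp only [hd, zero_smul, hχ.eventually_eq_one.self_of_nhds] at h
  exact h

variable [FiniteDimensional ℝ V] [MeasurableSpace V] [BorelSpace V]

/-- Integration in polar coordinates. -/
theorem integral_eq_integral_sphere (μ : Measure V) [μ.IsAddHaarMeasure] [Nontrivial V]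
    {g : V → ℝ} (hg : Integrable g μ) :
    ∫ x, g x ∂μ = ∫ θ : Metric.sphere (0 : V) 1, (∫ r in Ioi (0 : ℝ),
      r ^ (Module.finrank ℝ V - 1) * g (r • (θ : V))) ∂μ.toSphere := by
  have hmp := μ.measurePreserving_homeomorphUnitSphereProd
  let G : Metric.sphere (0 : V) 1 × Ioi (0 : ℝ) → ℝ := fun p => g ((p.2 : ℝ) • (p.1 : V))
  have hG : ∀ x : ({0}ᶜ : Set V), G (homeomorphUnitSphereProd V x) = g x := by
    intro x
    have hx : ‖(x : V)‖ ≠ 0 := norm_ne_zero_iff.2 x.2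
    simp [G, smul_smul, hx]
  have hint : Integrable G (μ.toSphere.prod (.volumeIoiPow (Module.finrank ℝ V - 1))) := by
    rw [← hmp.integrable_comp_emb (Homeomorph.measurableEmbedding _),
      show G ∘ homeomorphUnitSphereProd V = g ∘ (↑) from funext hG,
      ← integrableOn_iff_comap_subtypeVal (measurableSet_singleton _).compl]
    exact hg.integrableOn
  calc ∫ x, g x ∂μ = ∫ x : ({(0)}ᶜ : Set V), g x ∂(μ.comap (↑)) := by
        rw [integral_subtype_comap (measurableSet_singleton _).compl g, restrict_compl_singleton]
    _ = ∫ p, G p ∂μ.toSphere.prod (.volumeIoiPow (Module.finrank ℝ V - 1)) := by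
        rw [← hmp.integral_comp (Homeomorph.measurableEmbedding _)]
        simp only [hG]
    _ = _ := by
        rw [integral_prod _ hint]
        refine integral_congr_ae (Eventually.of_forall fun θ => ?_)
        simp only [Measure.volumeIoiPow, ENNReal.ofReal]
        rw [integral_withDensity_eq_integral_smul
            (measurable_subtype_coe.pow_const _).real_toNNReal,
          integral_subtype_comap measurableSet_Ioi fun a : ℝ =>
            Real.toNNReal (a ^ (Module.finrank ℝ V - 1)) • g (a • (θ : V))]
        refine setIntegral_congr_fun measurableSet_Ioi fun r hr => ?_
        simp only [NNReal.smul_def]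
        rw [Real.coe_toNNReal _ (pow_nonneg (le_of_lt hr) _), smul_eq_mul]

theorem integral_gaussian :
    ∫ x : V, Real.exp (-‖x‖ ^ 2) = Real.pi ^ ((Module.finrank ℝ V : ℝ) / 2) := by
  have h := GaussianFourier.integral_rexp_neg_mul_sq_norm (V := V) one_pos
  simpa using h

/-- The Gaussian integral in polar coordinates expresses the area of the unit sphere. -/
theorem toSphere_real_univ_mul_gaussMoment [Nontrivial V] :
    (volume : Measure V).toSphere.real univ * gaussMoment (Module.finrank ℝ V - 1)
      = ∫ x : V, Real.exp (-‖x‖ ^ 2) := by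
  rw [integral_fun_norm_addHaar volume fun r => Real.exp (-r ^ 2),
    Measure.toSphere_real_apply_univ, nsmul_eq_mul, smul_eq_mul, mul_assoc]
  have h := integral_exp_mul_pow (Module.finrank ℝ V - 1) one_pos
  simp only [one_pow, mul_one, inv_one] at h
  rw [← h]
  simp only [smul_eq_mul, mul_comm]

theorem IsCutoff.integrable_radial (hχ : IsCutoff χ) (n : ℕ) :
    Integrable fun x : V => ‖x‖⁻¹ ^ n * fderiv ℝ χ x x := by
  have hdχ : Continuous (fderiv ℝ χ) := hχ.contDiff.continuous_fderiv (by simp)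
  refine Continuous.integrable_of_hasCompactSupport ?_
    ((hχ.hasCompactSupport.fderiv (𝕜 := ℝ)).mono fun x hx h0 => hx ?_)
  · -- the function vanishes near the origin, where `‖x‖⁻¹` is not continuous
    rw [continuous_iff_continuousAt]
    intro x
    by_cases hx : x = 0
    · subst hx
      have h : (fun x : V => ‖x‖⁻¹ ^ n * fderiv ℝ χ x x) =ᶠ[𝓝 (0 : V)] fun _ => 0 := by
        filter_upwards [hχ.fderiv_eventually_eq_zero] with x hx
        rw [hx, zero_apply, mul_zero]
      exact continuousAt_const.congr h.symm
    · exact ((continuous_norm.continuousAt.inv₀ (norm_ne_zero_iff.2 hx)).pow n).mul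
        (hdχ.clm_apply continuous_id).continuousAt
  · simp only [h0, zero_apply, mul_zero]

theorem IsCutoff.integral_radial [Nontrivial V] (hχ : IsCutoff χ) :
    ∫ x : V, ‖x‖⁻¹ ^ Module.finrank ℝ V * fderiv ℝ χ x x
      = -(volume : Measure V).toSphere.real univ := by
  rw [integral_eq_integral_sphere volume (hχ.integrable_radial _)]
  have h : ∀ θ : Metric.sphere (0 : V) 1, ∫ r in Ioi (0 : ℝ), r ^ (Module.finrank ℝ V - 1) *
      (‖r • (θ : V)‖⁻¹ ^ Module.finrank ℝ V * fderiv ℝ χ (r • (θ : V)) (r • (θ : V))) = -1 := by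
    intro θ
    have hθ : ‖(θ : V)‖ = 1 := by simp
    rw [← hχ.integral_radial_deriv hθ]
    refine setIntegral_congr_fun measurableSet_Ioi fun r hr => ?_
    have hr' : (0 : ℝ) < r := hr
    obtain ⟨n, hn⟩ : ∃ n, Module.finrank ℝ V = n + 1 :=
      Nat.exists_eq_succ_of_ne_zero Module.finrank_pos.ne'
    simp only [norm_smul, hθ, mul_one, Real.norm_of_nonneg hr'.le, hn, Nat.add_sub_cancel,
      map_smul, smul_eq_mul, inv_pow]
    field_simp
    ring
  simp only [h]
  simp [measureReal_def]

end Polar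

/-! ### The integrals over `V` -/

section Integrals

theorem eps_ne_zero (d : ℕ) : eps d ≠ 0 :=
  mul_ne_zero (pow_ne_zero _ (by norm_num)) (Real.rpow_pos_of_pos Real.pi_pos _).ne'

theorem finrank_eq_of_orthonormalBasis {d : ℕ} (b : OrthonormalBasis (Fin d) ℝ V) :
    Module.finrank ℝ V = d := by
  simpa using Module.finrank_eq_card_basis b.toBasis

variable [FiniteDimensional ℝ V]

theorem thomCoeff_top_basis {d : ℕ} (b : OrthonormalBasis (Fin d) ℝ V) (X : so V) :
    thomCoeff b X d b = revSign d := by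
  have h := b.toBasis.det_self
  rw [b.coe_toBasis] at h
  rw [thomCoeff_top, h, mul_one]

theorem eq_zero_of_finrank_lt {k : ℕ} (h : Module.finrank ℝ V < k) (θ : V [⋀^Fin k]→L[ℝ] ℝ) :
    θ = 0 := by
  ext v
  refine θ.toAlternatingMap.map_linearDependent v fun hv => ?_
  have := hv.fintype_card_le_finrank
  rw [Fintype.card_fin] at this
  omega

/-- In top degree, `φ ∧ ι(x) θ = φ(x) θ`, because `φ ∧ θ` vanishes. -/
theorem wedgeOne_curryLeft_of_finrank_eq {k : ℕ} (h : Module.finrank ℝ V = k + 1)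
    (φ : V →L[ℝ] ℝ) (θ : V [⋀^Fin (k + 1)]→L[ℝ] ℝ) (x : V) :
    wedgeOne φ (θ.curryLeft x) = φ x • θ := by
  have h0 := curryLeft_wedgeOne_succ φ θ x
  rw [eq_zero_of_finrank_lt (by omega) (wedgeOne φ θ), ContinuousAlternatingMap.curryLeft_zero,
    zero_apply] at h0
  exact (sub_eq_zero.1 h0.symm).symm

variable [MeasurableSpace V] [BorelSpace V] {d : ℕ} (b : OrthonormalBasis (Fin d) ℝ V)

theorem eps_eq {d : ℕ} (b : OrthonormalBasis (Fin d) ℝ V) :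
    eps d = revSign d * ∫ x : V, Real.exp (-‖x‖ ^ 2) := by
  rw [integral_gaussian, finrank_eq_of_orthonormalBasis b]
  rfl

theorem formIntegral_cForm (X : so V) : formIntegral b (cForm b 1 X) = eps d := by
  rw [formIntegral, eps_eq b]
  simp only [cForm_one_eq, ContinuousAlternatingMap.smul_apply, thomCoeff_top_basis, smul_eq_mul]
  rw [integral_mul_const, mul_comm]

/-- For `d > 0`, the top-degree coefficient is `-½ Γ(d/2) (-1)^{d(d-1)/2} ‖x‖^{-d} dχ(x)(x)`. -/
theorem formIntegral_cutoffForm {χ : V → ℝ} (hχ : IsCutoff χ) (X : so V) :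
    formIntegral b (cutoffForm χ (pfForm b) (betaForm b) X) = eps d := by
  have hdim := finrank_eq_of_orthonormalBasis b
  rw [formIntegral, eps_eq b]
  cases d with
  | zero =>
    -- `V` is a point, where both the cut-off function and the Gaussian have the value `1`
    have hV : Subsingleton V := Module.finrank_zero_iff.1 hdim
    rw [← integral_const_mul]
    refine integral_congr_ae (Eventually.of_forall fun x => ?_)
    obtain rfl : x = 0 := Subsingleton.elim x 0
    have h := thomCoeff_top_basis b X
    simp only [← cutoffLinear_thomCoeff]
    change χ 0 * thomCoeff b X 0 b = _
    rw [h, hχ.eventually_eq_one.self_of_nhds]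
    simp
  | succ k =>
    have hV : Nontrivial V := Module.nontrivial_of_finrank_pos (R := ℝ) (by omega)
    have h : ∀ x, cutoffForm χ (pfForm b) (betaForm b) X (k + 1) x b
        = -(gaussMoment k * revSign (k + 1)) * (‖x‖⁻¹ ^ (k + 1) * fderiv ℝ χ x x) := by
      intro x
      rw [← cutoffLinear_thomCoeff]
      change wedgeOne (fderiv ℝ χ x)
        ((-(gaussMoment k) * ‖x‖⁻¹ ^ (k + 1)) • (thomCoeff b X (k + 1)).curryLeft x) b = _
      rw [wedgeOne_smul_right, wedgeOne_curryLeft_of_finrank_eq hdim,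
        ContinuousAlternatingMap.smul_apply, ContinuousAlternatingMap.smul_apply,
        thomCoeff_top_basis, smul_eq_mul, smul_eq_mul]
      ring
    have h1 := hχ.integral_radial
    have h2 := toSphere_real_univ_mul_gaussMoment (V := V)
    rw [hdim] at h1 h2
    rw [Nat.add_sub_cancel] at h2
    simp only [h]
    rw [integral_const_mul, h1, ← h2]
    ring

theorem formIntegral_smul (r : ℝ) (θ : MForm V) : formIntegral b (r • θ) = r * formIntegral b θ :=
  integral_const_mul r _

end Integrals

/-! ### The Thom forms -/

section Thom

theorem diffOn_eq_zero {U : Set V} {A : Submodule ℝ (EForm V)}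
    (hA : ∀ α ∈ A, ∀ X k, ∀ x ∈ U, DifferentiableAt ℝ (α X k) x) (α : A)
    (h : ∀ X k, ∀ x ∈ U, equivD (α : EForm V) X k x = 0) : diffOn U A hA α = 0 := by
  funext X k x
  change U.indicator _ x = _
  by_cases hx : x ∈ U
  · rw [indicator_of_mem hx]
    exact h X k x hx
  · rw [indicator_of_notMem hx]
    rfl

theorem cutoffForm_smul (χ : V → ℝ) (r : ℝ) (α β : EForm V) :
    cutoffForm χ (r • α) (r • β) = r • cutoffForm χ α β := by
  funext X k x
  cases k with
  | zero => exact smul_comm _ r _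
  | succ k =>
    change χ x • r • α X (k + 1) x + wedgeOne (fderiv ℝ χ x) (r • β X k x)
      = r • (χ x • α X (k + 1) x + wedgeOne (fderiv ℝ χ x) (β X k x))
    rw [wedgeOne_smul_right, smul_add, smul_comm]

theorem isThom_intro {E : Type*} [AddCommGroup E] [Module ℝ E] {A : Submodule ℝ E} {D : A →ₗ[ℝ] E}
    {P : LinearMap.ker D → Prop} (a : A) (h : D a = 0) (hP : P ⟨a, h⟩) : IsThom P (a : E) :=
  ⟨⟨a, h⟩, rfl, hP, ⟨a, h⟩, hP, rfl⟩

variable [FiniteDimensional ℝ V] [MeasurableSpace V] [BorelSpace V]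
  {d : ℕ} (b : OrthonormalBasis (Fin d) ℝ V)

theorem isThom_ThRel : IsThom (IsThomFormRel b) (ThRel b) := by
  have hmem : ThRel b ∈ ApolRel V :=
    Submodule.smul_mem _ _ ⟨pfForm_mem_Apol b, betaForm_mem_Apol b⟩
  refine isThom_intro ⟨ThRel b, hmem⟩ ?_ fun χ hχ X => ?_
  · refine Prod.ext ?_ ?_
    · funext X k x
      change (univ : Set V).indicator (equivD ((eps d)⁻¹ • pfForm b) X k) x = 0
      rw [indicator_of_mem (mem_univ x), equivD_smul_apply, equivD_pfForm, smul_zero]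
    · funext X k x
      change ({0}ᶜ : Set V).indicator ((eps d)⁻¹ • pfForm b X k) x
        - ({0}ᶜ : Set V).indicator (equivD ((eps d)⁻¹ • betaForm b) X k) x = 0
      by_cases hx : x ∈ ({0}ᶜ : Set V)
      · rw [indicator_of_mem hx, indicator_of_mem hx, equivD_smul_apply, equivD_betaForm b X k hx]
        exact sub_self _
      · rw [indicator_of_notMem hx, indicator_of_notMem hx, sub_zero]
  · change formIntegral b (cutoffForm χ ((eps d)⁻¹ • pfForm b) ((eps d)⁻¹ • betaForm b) X) = 1
    rw [cutoffForm_smul, Pi.smul_apply, formIntegral_smul, formIntegral_cutoffForm b hχ,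
      inv_mul_cancel₀ (eps_ne_zero d)]

theorem isThom_ThC {χ : V → ℝ} (hχ : IsCutoff χ) : IsThom (IsThomFormC b) (ThC b χ) := by
  have hmem : ThC b χ ∈ ApolC V := Submodule.smul_mem _ _ (cutoffForm_mem_ApolC b hχ)
  refine isThom_intro ⟨ThC b χ, hmem⟩ (diffOn_eq_zero _ _ fun X k x _ => ?_) fun X => ?_
  · change equivD ((eps d)⁻¹ • cutoffForm χ (pfForm b) (betaForm b)) X k x = 0
    rw [equivD_smul_apply, equivD_cutoffForm b hχ, smul_zero]
  · change formIntegral b ((eps d)⁻¹ • cutoffForm χ (pfForm b) (betaForm b) X) = 1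
    rw [formIntegral_smul, formIntegral_cutoffForm b hχ, inv_mul_cancel₀ (eps_ne_zero d)]

theorem isThom_ThMQ : IsThom (IsThomFormDR b) (ThMQ b) := by
  have hmem : ThMQ b ∈ ApolDR V := Submodule.smul_mem _ _ (cForm_mem_ApolDR b)
  refine isThom_intro ⟨ThMQ b, hmem⟩ (diffOn_eq_zero _ _ fun X k x _ => ?_) fun X => ?_
  · change equivD ((eps d)⁻¹ • cForm b 1) X k x = 0
    rw [equivD_smul_apply, equivD_cForm, smul_zero]
  · change formIntegral b ((eps d)⁻¹ • cForm b 1 X) = 1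
    rw [formIntegral_smul, formIntegral_cForm, inv_mul_cancel₀ (eps_ne_zero d)]

end Thom

end EquivariantThom

theorem mainTheorem1 {V : Type*} [NormedAddCommGroup V] [InnerProductSpace ℝ V]
    [FiniteDimensional ℝ V] [MeasurableSpace V] [BorelSpace V]
    {d : ℕ} (b : OrthonormalBasis (Fin d) ℝ V) :
    (∀ (X : so V) (k : ℕ) (x : V), x ≠ 0 →
      IntegrableOn (fun t : ℝ => etaForm b t X k x) (Ioi 0)) ∧
    IsThom (IsThomFormRel b) (ThRel b) ∧
    (∀ χ : V → ℝ, IsCutoff χ → IsThom (IsThomFormC b) (ThC b χ)) ∧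
    IsThom (IsThomFormDR b) (ThMQ b) :=
  ⟨fun X k _ hx => integrableOn_etaForm b X k hx, isThom_ThRel b, fun _ hχ => isThom_ThC b hχ,
    isThom_ThMQ b⟩
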